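/- **Proposition 5.9 (random block-coordinate forward-backward algorithm).** Let $\mathsf H_1,\dots,\mathsf H_m$ ($m\ge 1$) be separable real Hilbert spaces, let $\mathsf H=\mathsf H_1\oplus\cdots\oplus\mathsf H_m$ be their Hilbert direct sum, and let $(\Omega,\mathcal F,\mathsf P)$ be a probability space; random variables with values in a Hilbert space are measurable with respect to its Borel $\sigma$-algebra. Set $\mathsf D=\{0,1\}^m\smallsetminus\{0\}$. For every $i\in\{1,\dots,m\}$, let $\mathsf A_i\colon\mathsf H_i\to2^{\mathsf H_i}$ be maximally monotone and let $\mathsf B_i\colon\mathsf H\to\mathsf H_i$. Suppose that, for some $\vartheta\in\,]0,+\infty[$, $$\sum_{i=1}^m\langle \mathsf x_i-\mathsf y_i\mid \mathsf B_i\mathsf x-\mathsf B_i\mathsf y\rangle\ \ge\ \vartheta\sum_{i=1}^m\|\mathsf B_i\mathsf x-\mathsf B_i\mathsf y\|^2\qquad\text{for all }\mathsf x,\mathsf y\in\mathsf H,$$ and that the set $\mathsf F$ of all $\mathsf x=(\mathsf x_1,\dots,\mathsf x_m)\in\mathsf H$ such that $0\in\mathsf A_i\mathsf x_i+\mathsf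 B_i(\mathsf x_1,\dots,\mathsf x_m)$ for every $i\in\{1,\dots,m\}$ is nonempty. Let $(\gamma_n)_{n\in\mathbb N}$ be a sequence in $]0,2\vartheta[$ with $\inf_n\gamma_n>0$ and $\sup_n\gamma_n<2\vartheta$, and let $(\lambda_n)_{n\in\mathbb N}$ be a sequence in $]0,1]$ with $\inf_n\lambda_n>0$. Let $x_0$, $(a_n)_{n\in\mathbb N}$ and $(c_n)_{n\in\mathbb N}$ be $\mathsf H$-valued random variables, and let $(\varepsilon_n)_{n\in\mathbb N}$ be identically distributed $\mathsf D$-valued random variables. For $n=0,1,\dots$ and $i=1,\dots,m$, set $$x_{i,n+1}=x_{i,n}+\varepsilon_{i,n}\lambda_n\Big(\mathsf J_{\gamma_n\mathsf A_i}\big(x_{i,n}-\gamma_n(\mathsf B_i(x_{1,n},\dots,x_{m,n})+c_{i,n})\big)+a_{i,n}-x_{i,n}\Big),$$ where $\mathsf J_{\mathsf A}=(\mathrm{Id}+\mathsf A)^{-1}$ denotes the resolvent of $\mathsf A$. Let $\mathcal E_n=\sigma(\varepsilon_n)$ and $\mathcal X_n=\sigma(x_0,\dots,x_n)$, and assume the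 following. 1. $\sum_{n}\sqrt{\mathsf E(\|a_n\|^2\mid\mathcal X_n)}<+\infty$ and $\sum_{n}\sqrt{\mathsf E(\|c_n\|^2\mid\mathcal X_n)}<+\infty$ almost surely. 2. For every $n\in\mathbb N$, $\mathcal E_n$ and $\mathcal X_n$ are independent. 3. $\mathsf P[\varepsilon_{i,0}=1]>0$ for every $i\in\{1,\dots,m\}$. Then $(x_n)_{n\in\mathbb N}$ converges weakly almost surely to an $\mathsf F$-valued random variable $x$. If, in addition, one of the following holds: 4. for every $\mathsf x\in\mathsf F$ and every $i\in\{1,\dots,m\}$, $\mathsf A_i$ is demiregular at $\mathsf x_i$; 5. the operator $\mathsf x\mapsto(\mathsf B_i\mathsf x)_{1\le i\le m}$ is demiregular at every point of $\mathsf F$; then $(x_n)_{n\in\mathbb N}$ converges strongly almost surely to $x$. Here a set-valued operator $\mathsf A$ on a Hilbert space is called demiregular at a point $\mathsf x$ with $\mathsf A\mathsf x\neq\varnothing$ if, for every sequence $(\mathsf x_n,\mathsf u_n)_{n\in\mathbb N}$ in the graph of $\mathsf A$ and every $\mathsf u\in\mathsf A\mathsf x$ such that $\mathsf x_n\rightharpoonup\mathsf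 x$ and $\mathsf u_n\to\mathsf u$, one has $\mathsf x_n\to\mathsf x$. -/

import Mathlib

open MeasureTheory ProbabilityTheory Filter Topology Set
open scoped ENNReal RealInnerProductSpace Pointwise

namespace MonOp

section Operators

variable {H : Type*} [NormedAddCommGroup H] [InnerProductSpace ℝ H]

/-- Weak convergence of a sequence: convergence in the weak topology of `H`. -/
def WeaklyTendsTo (x : ℕ → H) (x' : H) : Prop :=
  Tendsto (fun n => toWeakSpace ℝ H (x n)) atTop (𝓝 (toWeakSpace ℝ H x'))

/-- A set-valued operator `A : H → 2^H` is monotone if `⟪x - y, u - v⟫ ≥ 0` for all `(x, u)` and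
`(y, v)` in its graph. -/
def IsMonotone (A : H → Set H) : Prop :=
  ∀ x y : H, ∀ u ∈ A x, ∀ v ∈ A y, 0 ≤ ⟪x - y, u - v⟫

/-- A monotone operator is maximally monotone if no monotone operator has a strictly larger graph
(the order on `H → Set H` is pointwise inclusion, that is, inclusion of graphs). -/
def IsMaximallyMonotone (A : H → Set H) : Prop :=
  Maximal IsMonotone A

/-- The set-valued resolvent `(Id + A)⁻¹`. -/
def resolventSet (A : H → Set H) (x : H) : Set H :=
  {y | ∃ u ∈ A y, x = y + u}

/-- The resolvent `J_A = (Id + A)⁻¹` as a function: `J A x` is a point `y` with `x ∈ y + A y`.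
For maximally monotone `A` such a point exists and is unique, for every `x`. -/
noncomputable def J (A : H → Set H) (x : H) : H :=
  Classical.epsilon fun y => y ∈ resolventSet A x

/-- `A` is demiregular at `x` (a point of its domain) if, for every sequence `(xₙ, uₙ)` in the graph
of `A` and every `u ∈ A x` such that `xₙ ⇀ x` and `uₙ → u`, one has `xₙ → x`. -/
def DemiregularAt (A : H → Set H) (x : H) : Prop :=
  (A x).Nonempty ∧
    ∀ (xs us : ℕ → H), (∀ n, us n ∈ A (xs n)) → ∀ u ∈ A x,
      WeaklyTendsTo xs x → Tendsto us atTop (𝓝 u) → Tendsto xs atTop (𝓝 x)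

end Operators

section Blocks

variable {m : ℕ} {E : Fin m → Type*} [∀ i, NormedAddCommGroup (E i)]
  [∀ i, InnerProductSpace ℝ (E i)]

/-- The solutions `x = (x₁, …, xₘ)` of `0 ∈ Aᵢ xᵢ + Bᵢ (x₁, …, xₘ)`, `i = 1, …, m`. -/
def solutions (A : ∀ i, E i → Set (E i)) (B : ∀ i, PiLp 2 E → E i) : Set (PiLp 2 E) :=
  {x | ∀ i, (0 : E i) ∈ A i (x i) + {B i x}}

/-- The operator `x ↦ (B₁ x, …, Bₘ x)` on the Hilbert direct sum. -/
def blockMap (B : ∀ i, PiLp 2 E → E i) (x : PiLp 2 E) : PiLp 2 E :=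
  WithLp.toLp 2 fun i => B i x

/-- The activation patterns `{0, 1}^m ∖ {0}`, as a set of real vectors. -/
def activations (m : ℕ) : Set (Fin m → ℝ) :=
  {d | (∀ i, d i = 0 ∨ d i = 1) ∧ d ≠ 0}

end Blocks

/-- On a finite Hilbert direct sum of separable Hilbert spaces, the measurable structure that
Mathlib provides is the Borel one. -/
theorem borelSpace_directSum {m : ℕ} {E : Fin m → Type*} [∀ i, NormedAddCommGroup (E i)]
    [∀ i, TopologicalSpace.SeparableSpace (E i)]
    [∀ i, MeasurableSpace (E i)] [∀ i, BorelSpace (E i)] : BorelSpace (PiLp 2 E) := by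
  have : ∀ i, SecondCountableTopology (E i) := fun i =>
    UniformSpace.secondCountable_of_separable (E i)
  infer_instance

/-- The σ-algebra `σ(x₀, …, xₙ)`. -/
abbrev history {Ω X : Type*} [MeasurableSpace X] (x : ℕ → Ω → X) (n : ℕ) : MeasurableSpace Ω :=
  ⨆ k ∈ Finset.range (n + 1), MeasurableSpace.comap (x k) inferInstance

/-- For random vectors `eₙ` and σ-algebras `𝒳ₙ`: `∑ₙ √(E[‖eₙ‖² | 𝒳ₙ]) < +∞` almost surely. The
conditional expectation is the `[0, +∞]`-valued one of a nonnegative random variable. -/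
def SummableCondErrors {Ω X : Type*} [NormedAddCommGroup X] {mΩ : MeasurableSpace Ω}
    (P : Measure Ω) (𝒳 : ℕ → MeasurableSpace Ω) (e : ℕ → Ω → X) : Prop :=
  ∀ᵐ ω ∂P, ∑' n, (condLExp (𝒳 n) P (fun ω' => ‖e n ω'‖ₑ ^ 2) ω) ^ (1 / 2 : ℝ) < ∞

end MonOp

namespace MonOp

section WeakConvergence

variable {H : Type*} [NormedAddCommGroup H] [InnerProductSpace ℝ H] {ι : Type*}

/-- Weak convergence along a filter, tested against inner products. -/
def TendstoWeakly (l : Filter ι) (x : ι → H) (w : H) : Prop :=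
  ∀ v : H, Tendsto (fun n => ⟪x n, v⟫) l (𝓝 ⟪w, v⟫)

theorem weaklyTendsTo_iff [CompleteSpace H] (x : ℕ → H) (w : H) :
    WeaklyTendsTo x w ↔ TendstoWeakly atTop x w := by
  unfold WeaklyTendsTo
  have hinj : Function.Injective (topDualPairing ℝ H).flip := by
    intro a b hab
    have h : ∀ f : StrongDual ℝ H, f a = f b := fun f => LinearMap.congr_fun hab f
    have := h (InnerProductSpace.toDual ℝ H (a - b))
    rw [InnerProductSpace.toDual_apply_apply, InnerProductSpace.toDual_apply_apply] at this
    rw [← sub_eq_zero, ← inner_sub_right, inner_self_eq_zero, sub_eq_zero] at this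
    exact this
  have key := WeakBilin.tendsto_iff_forall_eval_tendsto (topDualPairing ℝ H).flip (l := atTop)
    (f := fun n => toWeakSpace ℝ H (x n)) (x := toWeakSpace ℝ H w) hinj
  refine key.trans ⟨fun h v => ?_, fun h f => ?_⟩
  · have := h (InnerProductSpace.toDual ℝ H v)
    simp only [real_inner_comm v]
    exact this
  · have := h ((InnerProductSpace.toDual ℝ H).symm f)
    simp only [real_inner_comm ((InnerProductSpace.toDual ℝ H).symm f),
      InnerProductSpace.toDual_symm_apply] at this
    exact this

theorem TendstoWeakly.add_tendsto_zero {l : Filter ι} {x y : ι → H} {w : H}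
    (h : TendstoWeakly l x w) (hxy : Tendsto (fun n => y n - x n) l (𝓝 0)) :
    TendstoWeakly l y w := by
  intro v
  have h1 := (h v).add (hxy.inner (tendsto_const_nhds (x := v)))
  simpa [← inner_add_left] using h1

/-- The pairing of a bounded weakly convergent family with a strongly convergent one converges. -/
theorem TendstoWeakly.inner {l : Filter ι} {x y : ι → H} {w u : H} {R : ℝ}
    (h : TendstoWeakly l x w) (hR : ∀ n, ‖x n‖ ≤ R) (hy : Tendsto y l (𝓝 u)) :
    Tendsto (fun n => ⟪x n, y n⟫) l (𝓝 ⟪w, u⟫) := by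
  have h1 : Tendsto (fun n => ⟪x n, y n - u⟫) l (𝓝 0) := by
    have h0 : Tendsto (fun n => R * ‖y n - u‖) l (𝓝 0) := by
      have : Tendsto (fun n => ‖y n - u‖) l (𝓝 0) := tendsto_iff_norm_sub_tendsto_zero.1 hy
      simpa using this.const_mul R
    refine squeeze_zero_norm (fun n => ?_) h0
    exact (norm_inner_le_norm _ _).trans (mul_le_mul_of_nonneg_right (hR n) (norm_nonneg _))
  have h2 := h1.add (h u)
  simpa [inner_sub_right] using h2

/-- Bounded families in a Hilbert space converge weakly along every ultrafilter. -/
theorem exists_tendstoWeakly_of_bounded [CompleteSpace H] (𝒰 : Ultrafilter ι) {x : ι → H} {R : ℝ}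
    (hR : ∀ n, ‖x n‖ ≤ R) : ∃ w, TendstoWeakly (𝒰 : Filter ι) x w := by
  let y : ι → WeakDual ℝ H := fun n =>
    WeakDual.toStrongDual.symm (InnerProductSpace.toDual ℝ H (x n))
  have hK := WeakDual.isCompact_closedBall (𝕜 := ℝ) (E := H) 0 R
  have hy : ∀ n, y n ∈ WeakDual.toStrongDual ⁻¹' Metric.closedBall (0 : StrongDual ℝ H) R := by
    intro n
    simp only [mem_preimage, mem_closedBall_zero_iff, y, LinearEquiv.apply_symm_apply,
      LinearIsometryEquiv.norm_map]
    exact hR n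
  obtain ⟨f, -, hf⟩ := hK.ultrafilter_le_nhds (𝒰.map y)
    (le_principal_iff.2 (Filter.mem_map.2 (univ_mem' hy)))
  have hf' : Tendsto y 𝒰 (𝓝 f) := hf
  rw [tendsto_iff_forall_eval_tendsto_topDualPairing] at hf'
  refine ⟨(InnerProductSpace.toDual ℝ H).symm (WeakDual.toStrongDual f), fun v => ?_⟩
  rw [InnerProductSpace.toDual_symm_apply]
  exact hf' v

/-- Closed balls of a Hilbert space that meet finitely many at a time have a common point. -/
theorem exists_forall_norm_sub_le_of_finite [CompleteSpace H] (c : ι → H) (r : ι → ℝ)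
    (h : ∀ s : Finset ι, ∃ x, ∀ i ∈ s, ‖x - c i‖ ≤ r i) : ∃ x, ∀ i, ‖x - c i‖ ≤ r i := by
  rcases isEmpty_or_nonempty ι with hι | ⟨⟨i₀⟩⟩
  · exact ⟨0, fun i => hι.elim i⟩
  let D := InnerProductSpace.toDual ℝ H
  let t : ι → Set (WeakDual ℝ H) := fun i =>
    WeakDual.toStrongDual ⁻¹' Metric.closedBall (D (c i)) (r i)
  have hmem : ∀ (x : H) i, WeakDual.toStrongDual.symm (D x) ∈ t i ↔ ‖x - c i‖ ≤ r i := by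
    intro x i
    simp only [t, mem_preimage, LinearEquiv.apply_symm_apply, mem_closedBall_iff_norm, ← map_sub,
      LinearIsometryEquiv.norm_map]
  obtain ⟨f, -, hf⟩ := (WeakDual.isCompact_closedBall (𝕜 := ℝ) (D (c i₀)) (r i₀)).inter_iInter_nonempty
    t (fun i => WeakDual.isClosed_closedBall _ _) (fun s => by
      classical
      obtain ⟨x, hx⟩ := h (insert i₀ s)
      refine ⟨WeakDual.toStrongDual.symm (D x), (hmem x i₀).2 (hx i₀ (by simp)), ?_⟩
      simp only [mem_iInter]
      exact fun i hi => (hmem x i).2 (hx i (by simp [hi])))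
  refine ⟨D.symm (WeakDual.toStrongDual f), fun i => (hmem _ i).1 ?_⟩
  simpa using mem_iInter.1 hf i

end WeakConvergence

section Minty

variable {H : Type*} [NormedAddCommGroup H] [InnerProductSpace ℝ H]

theorem sum_sum_mul_norm_sub_sq {ι : Type*} [Fintype ι] (l : ι → ℝ) (hl : ∑ k, l k = 1)
    (c : ι → H) :
    ∑ j, ∑ k, l j * l k * ‖c j - c k‖ ^ 2 =
      2 * (∑ k, l k * ‖c k‖ ^ 2 - ‖∑ k, l k • c k‖ ^ 2) := by
  have h1 : ‖∑ k, l k • c k‖ ^ 2 = ∑ j, ∑ k, l j * l k * ⟪c j, c k⟫ := by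
    rw [← real_inner_self_eq_norm_sq, sum_inner]
    simp only [inner_sum, real_inner_smul_left, real_inner_smul_right]
    exact Finset.sum_congr rfl fun _ _ => Finset.sum_congr rfl fun _ _ => by ring
  have h2 : ∑ j, ∑ k, l j * l k * ‖c j‖ ^ 2 = ∑ k, l k * ‖c k‖ ^ 2 := by
    refine Finset.sum_congr rfl fun j _ => ?_
    rw [← Finset.sum_mul, ← Finset.mul_sum, hl, mul_one]
  have h3 : ∑ j, ∑ k, l j * l k * ‖c k‖ ^ 2 = ∑ k, l k * ‖c k‖ ^ 2 := by
    rw [Finset.sum_comm]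
    refine Finset.sum_congr rfl fun j _ => ?_
    rw [← Finset.sum_mul, ← Finset.sum_mul, hl, one_mul]
  have h4 : ∀ j k, l j * l k * ‖c j - c k‖ ^ 2 =
      l j * l k * ‖c j‖ ^ 2 + l j * l k * ‖c k‖ ^ 2 - 2 * (l j * l k * ⟪c j, c k⟫) := by
    intro j k
    rw [norm_sub_sq_real]; ring
  simp only [h4, Finset.sum_add_distrib, Finset.sum_sub_distrib, ← Finset.mul_sum]
  rw [h1, h2, h3]; ring

/-- Kirszbraun's intersection property for finitely many balls. -/
theorem exists_forall_norm_sub_le_of_contraction {ι : Type*} [Fintype ι] (c p : ι → H)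
    (h : ∀ j k, ‖c j - c k‖ ≤ ‖p j - p k‖) : ∃ x, ∀ k, ‖x - c k‖ ≤ ‖p k‖ := by
  classical
  rcases isEmpty_or_nonempty ι with hι | ⟨⟨i₀⟩⟩
  · exact ⟨0, fun i => hι.elim i⟩
  let d : ι → ℝ := fun k => ‖c k‖ ^ 2 - ‖p k‖ ^ 2
  let φ : (ι → ℝ) → ℝ := fun l => ∑ k, l k * d k - ‖∑ k, l k • c k‖ ^ 2
  have hφ : Continuous φ := by fun_prop
  obtain ⟨l, hl, hmax⟩ := (isCompact_stdSimplex ℝ ι).exists_isMaxOn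
    ⟨Pi.single i₀ 1, single_mem_stdSimplex ℝ i₀⟩ hφ.continuousOn
  have hl1 : ∑ k, l k = 1 := hl.2
  have hneg : φ l ≤ 0 := by
    have e1 := sum_sum_mul_norm_sub_sq l hl1 c
    have e2 := sum_sum_mul_norm_sub_sq l hl1 p
    have e3 : ∑ j, ∑ k, l j * l k * ‖c j - c k‖ ^ 2 ≤ ∑ j, ∑ k, l j * l k * ‖p j - p k‖ ^ 2 := by
      refine Finset.sum_le_sum fun j _ => Finset.sum_le_sum fun k _ => ?_
      have := mul_nonneg (hl.1 j) (hl.1 k)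
      have := h j k
      gcongr
    have e4 : φ l = ∑ k, l k * ‖c k‖ ^ 2 - ∑ k, l k * ‖p k‖ ^ 2 - ‖∑ k, l k • c k‖ ^ 2 := by
      simp only [φ, d, mul_sub, Finset.sum_sub_distrib]
    have := sq_nonneg ‖∑ k, l k • p k‖
    linarith
  set x := ∑ k, l k • c k with hx
  set D := ∑ k, l k * d k with hD
  have hDx : D - ‖x‖ ^ 2 ≤ 0 := hneg
  refine ⟨x, fun j => ?_⟩
  have hvar : ∀ t : ℝ, 0 < t → t ≤ 1 → d j - D - 2 * ⟪x, c j - x⟫ ≤ t * ‖c j - x‖ ^ 2 := by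
    intro t ht0 ht1
    let l' : ι → ℝ := (1 - t) • l + t • Pi.single j 1
    have hl' : l' ∈ stdSimplex ℝ ι :=
      convex_stdSimplex ℝ ι hl (single_mem_stdSimplex ℝ j) (by linarith) ht0.le (by ring)
    have hle : φ l' ≤ φ l := hmax hl'
    have s1 : ∑ k, l' k * d k = D + t * (d j - D) := by
      simp only [l', Pi.add_apply, Pi.smul_apply, smul_eq_mul, add_mul, Finset.sum_add_distrib,
        mul_assoc, ← Finset.mul_sum, ← hD]
      have : ∑ k, (Pi.single j (1 : ℝ) : ι → ℝ) k * d k = d j := by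
        simp [Pi.single_apply]
      rw [this]; ring
    have s2 : ∑ k, l' k • c k = x + t • (c j - x) := by
      simp only [l', Pi.add_apply, Pi.smul_apply, smul_eq_mul, add_smul, Finset.sum_add_distrib,
        mul_smul, ← Finset.smul_sum, ← hx]
      have : ∑ k, (Pi.single j (1 : ℝ) : ι → ℝ) k • c k = c j := by
        simp [Pi.single_apply, ite_smul]
      rw [this, smul_sub, sub_smul, one_smul]; abel
    have hle' : D + t * (d j - D) - ‖x + t • (c j - x)‖ ^ 2 ≤ D - ‖x‖ ^ 2 := by
      rw [← s1, ← s2]; exact hle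
    rw [norm_add_sq_real, norm_smul, real_inner_smul_right, mul_pow, Real.norm_eq_abs, sq_abs]
      at hle'
    have : t * (d j - D - 2 * ⟪x, c j - x⟫) ≤ t * (t * ‖c j - x‖ ^ 2) := by nlinarith
    exact le_of_mul_le_mul_left this ht0
  have hlim : d j - D - 2 * ⟪x, c j - x⟫ ≤ 0 := by
    refine le_of_forall_pos_le_add fun e he => ?_
    have hpos : 0 < ‖c j - x‖ ^ 2 + 1 := by positivity
    have := hvar (min 1 (e / (‖c j - x‖ ^ 2 + 1))) (lt_min one_pos (div_pos he hpos))
      (min_le_left _ _)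
    have h2 : min 1 (e / (‖c j - x‖ ^ 2 + 1)) * ‖c j - x‖ ^ 2 ≤ e := by
      calc _ ≤ e / (‖c j - x‖ ^ 2 + 1) * (‖c j - x‖ ^ 2 + 1) := by
            gcongr
            · exact min_le_right _ _
            · linarith
        _ = e := div_mul_cancel₀ _ hpos.ne'
    linarith
  rw [inner_sub_right, real_inner_self_eq_norm_sq] at hlim
  have hsq : ‖x - c j‖ ^ 2 ≤ ‖p j‖ ^ 2 := by
    rw [norm_sub_sq_real]
    simp only [d] at hlim
    linarith
  exact (pow_le_pow_iff_left₀ (norm_nonneg _) (norm_nonneg _) two_ne_zero).1 hsq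

/-- Every monotone family of pairs `(y, v)` admits a point `x` such that `(x, -x)` is monotonically
related to all its members. -/
theorem exists_monotonically_related [CompleteSpace H] (G : Set (H × H))
    (hG : ∀ a ∈ G, ∀ b ∈ G, 0 ≤ ⟪a.1 - b.1, a.2 - b.2⟫) :
    ∃ x : H, ∀ a ∈ G, 0 ≤ ⟪a.1 - x, a.2 + x⟫ := by
  let c : G → H := fun a => (2⁻¹ : ℝ) • (a.1.1 - a.1.2)
  let p : G → H := fun a => (2⁻¹ : ℝ) • (a.1.1 + a.1.2)
  have hcp : ∀ a b, ‖c a - c b‖ ≤ ‖p a - p b‖ := by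
    intro a b
    have h1 : c a - c b = (2⁻¹ : ℝ) • ((a.1.1 - b.1.1) - (a.1.2 - b.1.2)) := by
      simp only [c, ← smul_sub]; congr 1; abel
    have h2 : p a - p b = (2⁻¹ : ℝ) • ((a.1.1 - b.1.1) + (a.1.2 - b.1.2)) := by
      simp only [p, ← smul_sub]; congr 1; abel
    rw [h1, h2, norm_smul, norm_smul]
    refine mul_le_mul_of_nonneg_left ?_ (norm_nonneg _)
    rw [← pow_le_pow_iff_left₀ (norm_nonneg _) (norm_nonneg _) two_ne_zero, norm_sub_sq_real,
      norm_add_sq_real]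
    linarith [hG a a.2 b b.2]
  obtain ⟨x, hx⟩ := exists_forall_norm_sub_le_of_finite c (fun a => ‖p a‖) fun s => by
    obtain ⟨x, hx⟩ := exists_forall_norm_sub_le_of_contraction (fun a : s => c a) (fun a : s => p a)
      fun a b => hcp a b
    exact ⟨x, fun i hi => hx ⟨i, hi⟩⟩
  refine ⟨x, fun a ha => ?_⟩
  have h := hx ⟨a, ha⟩
  rw [← pow_le_pow_iff_left₀ (norm_nonneg _) (norm_nonneg _) two_ne_zero, norm_sub_sq_real] at h
  simp only [c, p, norm_smul, mul_pow, norm_sub_sq_real, norm_add_sq_real, real_inner_smul_right,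
    inner_sub_right] at h
  norm_num at h
  rw [inner_add_right, inner_sub_left, inner_sub_left, real_inner_self_eq_norm_sq,
    real_inner_comm x a.1]
  linarith

theorem IsMaximallyMonotone.mem_of_forall {A : H → Set H} (hA : IsMaximallyMonotone A) {x u : H}
    (h : ∀ y, ∀ v ∈ A y, 0 ≤ ⟪x - y, u - v⟫) : u ∈ A x := by
  let C : H → Set H := fun y => A y ∪ {v | y = x ∧ v = u}
  have hC : IsMonotone C := by
    rintro y z v (hv | ⟨rfl, rfl⟩) w (hw | ⟨rfl, rfl⟩)
    · exact hA.1 y z v hv w hw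
    · have := h y v hv
      rw [← neg_sub y, ← neg_sub v, inner_neg_neg] at this
      exact this
    · exact h z w hw
    · simp
  exact hA.2 hC (fun y => subset_union_left) x (Or.inr ⟨rfl, rfl⟩)

/-- **Minty's theorem**, for the operator `γ A`. -/
theorem IsMaximallyMonotone.exists_resolvent [CompleteSpace H] {A : H → Set H}
    (hA : IsMaximallyMonotone A) {γ : ℝ} (hγ : 0 < γ) (z : H) : ∃ x, γ⁻¹ • (z - x) ∈ A x := by
  let G : Set (H × H) := {a | ∃ v ∈ A a.1, a.2 = γ • v - z}
  obtain ⟨x, hx⟩ := exists_monotonically_related G (by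
    rintro ⟨y, _⟩ ⟨v, hv, rfl⟩ ⟨y', _⟩ ⟨v', hv', rfl⟩
    have : γ • v - z - (γ • v' - z) = γ • (v - v') := by rw [smul_sub]; abel
    simp only [this, real_inner_smul_right]
    exact mul_nonneg hγ.le (hA.1 _ _ _ hv _ hv'))
  refine ⟨x, hA.mem_of_forall fun y v hv => ?_⟩
  have h := hx (y, γ • v - z) ⟨v, hv, rfl⟩
  have e : γ • v - z + x = γ • -(γ⁻¹ • (z - x) - v) := by
    rw [smul_neg, smul_sub, smul_inv_smul₀ hγ.ne']; abel
  simp only [e, real_inner_smul_right, inner_neg_right, ← neg_sub x y, inner_neg_left, mul_neg,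
    neg_neg] at h
  exact (mul_nonneg_iff_of_pos_left hγ).1 h

end Minty

section Resolvent

variable {H : Type*} [NormedAddCommGroup H] [InnerProductSpace ℝ H]

theorem mem_resolventSet_smul_iff {A : H → Set H} {γ : ℝ} (hγ : 0 < γ) {z y : H} :
    y ∈ resolventSet (γ • A) z ↔ γ⁻¹ • (z - y) ∈ A y := by
  constructor
  · rintro ⟨u, ⟨v, hv, rfl⟩, rfl⟩
    simpa [inv_smul_smul₀ hγ.ne'] using hv
  · intro h
    refine ⟨z - y, ⟨_, h, ?_⟩, by abel⟩
    simp [smul_inv_smul₀ hγ.ne']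

theorem IsMaximallyMonotone.smul_sub_J_mem [CompleteSpace H] {A : H → Set H}
    (hA : IsMaximallyMonotone A) {γ : ℝ} (hγ : 0 < γ) (z : H) :
    γ⁻¹ • (z - J (γ • A) z) ∈ A (J (γ • A) z) := by
  obtain ⟨x, hx⟩ := hA.exists_resolvent hγ z
  exact (mem_resolventSet_smul_iff hγ).1
    (Classical.epsilon_spec ⟨x, (mem_resolventSet_smul_iff hγ).2 hx⟩)

theorem IsMonotone.inner_sub_nonneg {A : H → Set H} (hA : IsMonotone A) {γ : ℝ} (hγ : 0 < γ)
    {z z' y y' : H} (h : γ⁻¹ • (z - y) ∈ A y) (h' : γ⁻¹ • (z' - y') ∈ A y') :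
    0 ≤ ⟪y - y', (z - y) - (z' - y')⟫ := by
  have := hA y y' _ h _ h'
  rw [← smul_sub, real_inner_smul_right] at this
  exact (mul_nonneg_iff_of_pos_left (inv_pos.2 hγ)).1 this

/-- Firm nonexpansiveness of the resolvent. -/
theorem IsMonotone.norm_sub_sq_add_le {A : H → Set H} (hA : IsMonotone A) {γ : ℝ} (hγ : 0 < γ)
    {z z' y y' : H} (h : γ⁻¹ • (z - y) ∈ A y) (h' : γ⁻¹ • (z' - y') ∈ A y') :
    ‖y - y'‖ ^ 2 + ‖(z - y) - (z' - y')‖ ^ 2 ≤ ‖z - z'‖ ^ 2 := by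
  have h1 := hA.inner_sub_nonneg hγ h h'
  have h2 : z - z' = (y - y') + ((z - y) - (z' - y')) := by abel
  rw [h2, norm_add_sq_real]
  linarith

theorem IsMaximallyMonotone.norm_J_sub_le [CompleteSpace H] {A : H → Set H}
    (hA : IsMaximallyMonotone A) {γ : ℝ} (hγ : 0 < γ) (z z' : H) :
    ‖J (γ • A) z - J (γ • A) z'‖ ≤ ‖z - z'‖ := by
  rw [← pow_le_pow_iff_left₀ (norm_nonneg _) (norm_nonneg _) two_ne_zero]
  have := hA.1.norm_sub_sq_add_le hγ (hA.smul_sub_J_mem hγ z) (hA.smul_sub_J_mem hγ z')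
  linarith [sq_nonneg ‖z - J (γ • A) z - (z' - J (γ • A) z')‖]

theorem IsMaximallyMonotone.continuous_J [CompleteSpace H] {A : H → Set H}
    (hA : IsMaximallyMonotone A) {γ : ℝ} (hγ : 0 < γ) : Continuous (J (γ • A)) :=
  (LipschitzWith.of_dist_le_mul (K := 1) fun z z' => by
    simpa [dist_eq_norm] using hA.norm_J_sub_le hγ z z').continuous

/-- The graph of a maximally monotone operator is closed for bounded weak × strong convergence. -/
theorem IsMaximallyMonotone.mem_of_tendsto {ι : Type*} {l : Filter ι} [l.NeBot] {A : H → Set H}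
    (hA : IsMaximallyMonotone A) {x u : ι → H} {w v : H} {R : ℝ} (hR : ∀ n, ‖x n‖ ≤ R)
    (hx : TendstoWeakly l x w) (hu : Tendsto u l (𝓝 v)) (hxu : ∀ n, u n ∈ A (x n)) : v ∈ A w := by
  refine hA.mem_of_forall fun y q hq => ?_
  have hx' : TendstoWeakly l (fun n => x n - y) (w - y) := fun p => by
    simpa [inner_sub_left] using (hx p).sub_const ⟪y, p⟫
  have hlim := hx'.inner (R := R + ‖y‖) (fun n => (norm_sub_le _ _).trans (by gcongr; exact hR n))
    (hu.sub_const q)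
  exact ge_of_tendsto' hlim fun n => hA.1 _ _ _ (hxu n) _ hq

end Resolvent

end MonOp
namespace MonOp

section AlmostSupermartingale

open scoped NNReal

variable {Ω : Type*} {mΩ : MeasurableSpace Ω} {P : Measure Ω} [IsFiniteMeasure P]
  {ℱ : Filtration ℕ mΩ}

/-- Nonnegative supermartingales converge almost surely. -/
theorem ae_exists_tendsto_of_setLIntegral_le {M : ℕ → Ω → ℝ≥0} (hM : ∀ n, Measurable[ℱ n] (M n))
    (h0 : ∫⁻ ω, M 0 ω ∂P ≠ ∞)
    (hle : ∀ n s, MeasurableSet[ℱ n] s → ∫⁻ ω in s, M (n + 1) ω ∂P ≤ ∫⁻ ω in s, M n ω ∂P) :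
    ∀ᵐ ω ∂P, ∃ l : ℝ≥0, Tendsto (fun n => M n ω) atTop (𝓝 l) := by
  have hMm : ∀ n, Measurable (M n) := fun n => (hM n).mono (ℱ.le n) le_rfl
  have hint : ∀ n, ∫⁻ ω, M n ω ∂P ≤ ∫⁻ ω, M 0 ω ∂P := by
    intro n
    induction n with
    | zero => exact le_rfl
    | succ n ih =>
      have := hle n univ MeasurableSet.univ
      simp only [Measure.restrict_univ] at this
      exact this.trans ih
  have hfin : ∀ n, ∫⁻ ω, M n ω ∂P ≠ ∞ := fun n => ne_top_of_le_ne_top h0 (hint n)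
  have hI : ∀ n, Integrable (fun ω => (M n ω : ℝ)) P := fun n =>
    ⟨(hMm n).coe_nnreal_real.aestronglyMeasurable, by
      simpa [HasFiniteIntegral] using lt_top_iff_ne_top.2 (hfin n)⟩
  have hset : ∀ n (s : Set Ω), ∫ ω in s, (M n ω : ℝ) ∂P = (∫⁻ ω in s, M n ω ∂P).toReal := by
    intro n s
    rw [integral_eq_lintegral_of_nonneg_ae (ae_of_all _ fun ω => NNReal.coe_nonneg _)
      (hMm n).coe_nnreal_real.aestronglyMeasurable]
    simp
  have hsuper : Supermartingale (fun n ω => (M n ω : ℝ)) ℱ P := by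
    refine supermartingale_of_setIntegral_succ_le
      (fun n => Measurable.stronglyMeasurable (hM n).coe_nnreal_real) hI fun n s hs => ?_
    rw [hset, hset]
    exact ENNReal.toReal_mono
      (ne_top_of_le_ne_top (hfin n) (setLIntegral_le_lintegral _ _)) (hle n s hs)
  have hbdd : ∀ n, eLpNorm ((-fun n ω => (M n ω : ℝ)) n) 1 P ≤
      ((∫⁻ ω, M 0 ω ∂P).toNNReal : ℝ≥0∞) := by
    intro n
    rw [ENNReal.coe_toNNReal h0, eLpNorm_one_eq_lintegral_enorm]
    simpa using hint n
  filter_upwards [hsuper.neg.exists_ae_tendsto_of_bdd hbdd] with ω hω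
  obtain ⟨c, hc⟩ := hω
  have hc' : Tendsto (fun n => (M n ω : ℝ)) atTop (𝓝 (-c)) := by simpa using hc.neg
  have hc0 : 0 ≤ -c := ge_of_tendsto' hc' fun n => NNReal.coe_nonneg _
  exact ⟨⟨-c, hc0⟩, NNReal.tendsto_coe.1 hc'⟩

/-- A nonnegative adapted process that decreases in conditional mean, up to a bounded total error,
converges almost surely, and the decrease is summable. -/
theorem ae_summable_and_tendsto_of_bounded_error {U g β : ℕ → Ω → ℝ≥0} {R : ℝ≥0}
    (hU : ∀ n, Measurable[ℱ n] (U n)) (hg : ∀ n, Measurable[ℱ n] (g n))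
    (hβ : ∀ n, Measurable[ℱ n] (β n)) (h0 : ∀ ω, U 0 ω ≤ R)
    (hR : ∀ n ω, ∑ k ∈ Finset.range n, β k ω ≤ R)
    (hle : ∀ n s, MeasurableSet[ℱ n] s →
      ∫⁻ ω in s, (U (n + 1) ω + g n ω) ∂P ≤ ∫⁻ ω in s, (U n ω + β n ω) ∂P) :
    ∀ᵐ ω ∂P, Summable (fun n => g n ω) ∧ ∃ l : ℝ≥0, Tendsto (fun n => U n ω) atTop (𝓝 l) := by
  let M : ℕ → Ω → ℝ≥0 := fun n ω =>
    U n ω + ∑ k ∈ Finset.range n, g k ω + (R - ∑ k ∈ Finset.range n, β k ω)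
  have hsum : ∀ {f : ℕ → Ω → ℝ≥0}, (∀ n, Measurable[ℱ n] (f n)) → ∀ n,
      Measurable[ℱ n] (fun ω => ∑ k ∈ Finset.range n, f k ω) := fun hf n =>
    Finset.measurable_fun_sum _ fun k hk =>
      (hf k).mono (ℱ.mono (Finset.mem_range.1 hk).le) le_rfl
  have hM : ∀ n, Measurable[ℱ n] (M n) := fun n =>
    ((hU n).add (hsum hg n)).add (Measurable.sub measurable_const (hsum hβ n))
  have hstep : ∀ n ω, (M (n + 1) ω : ℝ≥0∞) + β n ω = (U (n + 1) ω + g n ω : ℝ≥0∞) +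
      ((∑ k ∈ Finset.range n, g k ω + (R - ∑ k ∈ Finset.range n, β k ω) : ℝ≥0) : ℝ≥0∞) := by
    intro n ω
    have h1 : R - ∑ k ∈ Finset.range (n + 1), β k ω + β n ω =
        R - ∑ k ∈ Finset.range n, β k ω := by
      have := hR (n + 1) ω
      rw [← NNReal.coe_inj, NNReal.coe_add, NNReal.coe_sub this, NNReal.coe_sub (hR n ω),
        Finset.sum_range_succ, NNReal.coe_add]
      ring
    norm_cast
    simp only [M]
    rw [add_assoc, h1, Finset.sum_range_succ]
    ring
  have hconv := ae_exists_tendsto_of_setLIntegral_le (P := P) hM (by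
    have : ∀ ω, (M 0 ω : ℝ≥0∞) ≤ (R + R : ℝ≥0) := fun ω => by
      norm_cast
      simpa [M] using h0 ω
    refine ne_top_of_le_ne_top ?_ (lintegral_mono this)
    rw [lintegral_const]
    exact ENNReal.mul_ne_top ENNReal.coe_ne_top (measure_ne_top _ _)) (fun n s hs => by
    have hβm : Measurable fun ω => (β n ω : ℝ≥0∞) :=
      ((hβ n).mono (ℱ.le n) le_rfl).coe_nnreal_ennreal
    have hcm : Measurable fun ω =>
        ((∑ k ∈ Finset.range n, g k ω + (R - ∑ k ∈ Finset.range n, β k ω) : ℝ≥0) : ℝ≥0∞) :=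
      (((hsum hg n).add (Measurable.sub measurable_const (hsum hβ n))).mono
        (ℱ.le n) le_rfl).coe_nnreal_ennreal
    have hβfin : ∫⁻ ω in s, β n ω ∂P ≠ ∞ := by
      have : ∀ ω, (β n ω : ℝ≥0∞) ≤ R := fun ω => by
        norm_cast
        exact (Finset.single_le_sum (f := fun k => β k ω) (fun _ _ => zero_le)
          (Finset.self_mem_range_succ n)).trans (hR (n + 1) ω)
      refine ne_top_of_le_ne_top ?_ (lintegral_mono this)
      rw [lintegral_const]
      exact ENNReal.mul_ne_top ENNReal.coe_ne_top (measure_ne_top _ _)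
    refine (ENNReal.add_le_add_iff_right hβfin).1 ?_
    rw [← lintegral_add_right _ hβm, ← lintegral_add_right _ hβm]
    simp only [hstep]
    rw [lintegral_add_right _ hcm]
    refine (add_le_add (hle n s hs) le_rfl).trans_eq ?_
    rw [← lintegral_add_right _ hcm]
    refine lintegral_congr fun ω => ?_
    norm_cast
    simp only [M]
    ring)
  filter_upwards [hconv] with ω hω
  obtain ⟨c, hc⟩ := hω
  have hMb : ∃ K, ∀ n, M n ω ≤ K := by
    obtain ⟨K, hK⟩ := hc.bddAbove_range
    exact ⟨K, fun n => hK (mem_range_self n)⟩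
  obtain ⟨K, hK⟩ := hMb
  have hgs : Summable fun n => g n ω := NNReal.summable_of_sum_range_le (c := K) fun n =>
    (le_add_self.trans le_self_add).trans (hK n)
  have hβs : Summable fun n => β n ω := NNReal.summable_of_sum_range_le (c := R) fun n => hR n ω
  refine ⟨hgs, ?_⟩
  have hUr : ∀ n, (U n ω : ℝ) = M n ω - ∑ k ∈ Finset.range n, (g k ω : ℝ) -
      (R - ∑ k ∈ Finset.range n, (β k ω : ℝ)) := by
    intro n
    simp only [M, NNReal.coe_add, NNReal.coe_sub (hR n ω), NNReal.coe_sum]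
    ring
  have hg' := (NNReal.summable_coe.2 hgs).hasSum.tendsto_sum_nat
  have hβ' := (NNReal.summable_coe.2 hβs).hasSum.tendsto_sum_nat
  have hlim := ((NNReal.tendsto_coe.2 hc).sub hg').sub (hβ'.const_sub (R : ℝ))
  simp only [← hUr] at hlim
  have h0' := ge_of_tendsto' hlim fun n => NNReal.coe_nonneg _
  exact ⟨⟨_, h0'⟩, NNReal.tendsto_coe.1 hlim⟩

/-- The Robbins–Siegmund theorem without multiplicative perturbation. -/
theorem ae_summable_and_tendsto_of_summable_error {V g β : ℕ → Ω → ℝ≥0}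
    (hV : ∀ n, Measurable[ℱ n] (V n)) (hg : ∀ n, Measurable[ℱ n] (g n))
    (hβ : ∀ n, Measurable[ℱ n] (β n)) (hβs : ∀ᵐ ω ∂P, Summable fun n => β n ω)
    (hle : ∀ n s, MeasurableSet[ℱ n] s →
      ∫⁻ ω in s, (V (n + 1) ω + g n ω) ∂P ≤ ∫⁻ ω in s, (V n ω + β n ω) ∂P) :
    ∀ᵐ ω ∂P, Summable (fun n => g n ω) ∧ ∃ l : ℝ≥0, Tendsto (fun n => V n ω) atTop (𝓝 l) := by
  let G : ℕ → ℕ → Set Ω := fun R n => {ω | V 0 ω ≤ R ∧ ∑ k ∈ Finset.range n, β k ω ≤ R}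
  have hGanti : ∀ R, Antitone (G R) := fun R i j hij ω hω =>
    ⟨hω.1, (Finset.sum_le_sum_of_subset (Finset.range_subset_range.2 hij)).trans hω.2⟩
  have hGm : ∀ R n, MeasurableSet[ℱ n] (G R (n + 1)) := by
    intro R n
    refine @MeasurableSet.inter _ (ℱ n) _ _ ?_ ?_
    · exact ((hV 0).mono (ℱ.mono (Nat.zero_le n)) le_rfl) measurableSet_Iic
    · have : Measurable[ℱ n] fun ω => ∑ k ∈ Finset.range (n + 1), β k ω :=
        Finset.measurable_fun_sum _ fun k hk =>
          (hβ k).mono (ℱ.mono (Nat.lt_succ_iff.1 (Finset.mem_range.1 hk))) le_rfl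
      exact this measurableSet_Iic
  have hGm' : ∀ R n, MeasurableSet[ℱ n] (G R n) := by
    intro R n
    cases n with
    | zero =>
      have : G R 0 = {ω | V 0 ω ≤ R} := by ext ω; simp [G]
      rw [this]
      exact (hV 0) measurableSet_Iic
    | succ n => exact ℱ.mono n.le_succ _ (hGm R n)
  have key : ∀ R : ℕ, ∀ᵐ ω ∂P, Summable (fun n => (G R (n + 1)).indicator (g n) ω) ∧
      ∃ l : ℝ≥0, Tendsto (fun n => (G R n).indicator (V n) ω) atTop (𝓝 l) := by
    intro R
    refine ae_summable_and_tendsto_of_bounded_error (ℱ := ℱ) (R := R)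
      (β := fun n => (G R (n + 1)).indicator (β n))
      (fun n => (hV n).indicator (hGm' R n)) (fun n => (hg n).indicator (hGm R n))
      (fun n => (hβ n).indicator (hGm R n)) (fun ω => ?_) (fun n ω => ?_) (fun n s hs => ?_)
    · by_cases h : ω ∈ G R 0
      · rw [indicator_of_mem h]; exact h.1
      · rw [indicator_of_notMem h]; exact zero_le
    · induction n with
      | zero => simp
      | succ n ih =>
        by_cases h : ω ∈ G R (n + 1)
        · refine le_trans (Finset.sum_le_sum fun k _ => ?_) h.2
          exact indicator_le_self _ _ _
        · rw [Finset.sum_range_succ, indicator_of_notMem h, add_zero]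
          exact ih
    · have hms : MeasurableSet (G R (n + 1)) := ℱ.le n _ (hGm R n)
      have h1 := hle n (G R (n + 1) ∩ s) (@MeasurableSet.inter _ (ℱ n) _ _ (hGm R n) hs)
      rw [← Measure.restrict_restrict hms, ← lintegral_indicator hms, ← lintegral_indicator hms] at h1
      refine le_trans (lintegral_mono fun ω => ?_) (h1.trans (lintegral_mono fun ω => ?_))
      · by_cases h : ω ∈ G R (n + 1) <;> simp [h]
      · by_cases h : ω ∈ G R (n + 1)
        · simp [h, hGanti R n.le_succ h]
        · simp [h]
  filter_upwards [ae_all_iff.2 key, hβs] with ω hω hs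
  obtain ⟨R, hR⟩ := exists_nat_ge (max (V 0 ω) (∑' n, β n ω))
  have hmem : ∀ n, ω ∈ G R n := fun n =>
    ⟨(le_max_left _ _).trans hR, (hs.sum_le_tsum _ fun _ _ => zero_le).trans
      ((le_max_right _ _).trans hR)⟩
  simpa [hmem] using hω R

/-- The **Robbins–Siegmund theorem**, with the conditional inequality stated in integrated form. No
integrability is required. -/
theorem ae_summable_and_tendsto_of_almost_supermartingale {V g ξ β : ℕ → Ω → ℝ≥0}
    (hV : ∀ n, Measurable[ℱ n] (V n)) (hg : ∀ n, Measurable[ℱ n] (g n))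
    (hξ : ∀ n, Measurable[ℱ n] (ξ n)) (hβ : ∀ n, Measurable[ℱ n] (β n))
    (hξs : ∀ᵐ ω ∂P, Summable fun n => ξ n ω) (hβs : ∀ᵐ ω ∂P, Summable fun n => β n ω)
    (hle : ∀ n (h : Ω → ℝ≥0), Measurable[ℱ n] h →
      ∫⁻ ω, h ω * (V (n + 1) ω + g n ω) ∂P ≤ ∫⁻ ω, h ω * ((1 + ξ n ω) * V n ω + β n ω) ∂P) :
    ∀ᵐ ω ∂P, Summable (fun n => g n ω) ∧ ∃ l : ℝ≥0, Tendsto (fun n => V n ω) atTop (𝓝 l) := by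
  let D : ℕ → Ω → ℝ≥0 := fun n ω => ∏ k ∈ Finset.range n, (1 + ξ k ω)
  have hD1 : ∀ n ω, 1 ≤ D n ω := fun n ω => Finset.one_le_prod' fun k _ => le_self_add
  have hD0 : ∀ n ω, D n ω ≠ 0 := fun n ω => (zero_lt_one.trans_le (hD1 n ω)).ne'
  have hDsucc : ∀ n ω, D (n + 1) ω = D n ω * (1 + ξ n ω) := fun n ω => Finset.prod_range_succ _ _
  have hDm' : ∀ n, Measurable[ℱ n] (D (n + 1)) := fun n =>
    Finset.measurable_fun_prod _ fun k hk => (measurable_const.add (hξ k)).mono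
      (ℱ.mono (Nat.lt_succ_iff.1 (Finset.mem_range.1 hk))) le_rfl
  have hDm : ∀ n, Measurable[ℱ n] (D n) := fun n =>
    Finset.measurable_fun_prod _ fun k hk => (measurable_const.add (hξ k)).mono
      (ℱ.mono (Finset.mem_range.1 hk).le) le_rfl
  have key := ae_summable_and_tendsto_of_summable_error (P := P) (ℱ := ℱ)
    (V := fun n ω => V n ω / D n ω) (g := fun n ω => g n ω / D (n + 1) ω)
    (β := fun n ω => β n ω / D (n + 1) ω) (fun n => (hV n).div (hDm n))
    (fun n => (hg n).div (hDm' n)) (fun n => (hβ n).div (hDm' n)) (by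
      filter_upwards [hβs] with ω hω
      exact NNReal.summable_of_le (fun n => div_le_self zero_le (hD1 _ ω)) hω)
    (fun n s hs => by
      have h1 := hle n (s.indicator fun ω => (D (n + 1) ω)⁻¹) ((hDm' n).inv.indicator hs)
      have hms : MeasurableSet s := ℱ.le n _ hs
      rw [← lintegral_indicator hms, ← lintegral_indicator hms]
      refine le_trans (lintegral_mono fun ω => ?_) (h1.trans (lintegral_mono fun ω => ?_))
      · by_cases h : ω ∈ s
        · simp only [h, indicator_of_mem]
          norm_cast
          rw [div_eq_inv_mul, div_eq_inv_mul, mul_add]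
        · simp [h]
      · by_cases h : ω ∈ s
        · simp only [h, indicator_of_mem]
          norm_cast
          have h2 : (1 + ξ n ω) ≠ 0 := (zero_lt_one.trans_le le_self_add).ne'
          have h3 := hD0 n ω
          rw [hDsucc, mul_add]
          refine le_of_eq ?_
          field_simp
        · simp [h])
  filter_upwards [key, hξs] with ω hω hs
  obtain ⟨hgs, l, hl⟩ := hω
  have hDlim : ∃ d : ℝ≥0, Tendsto (fun n => D n ω) atTop (𝓝 d) := by
    have h1 := (Real.multipliable_one_add_of_summable
      (NNReal.summable_coe.2 hs)).hasProd.tendsto_prod_nat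
    have h2 : Tendsto (fun n => (D n ω : ℝ)) atTop (𝓝 (∏' n, (1 + (ξ n ω : ℝ)))) := by
      simpa [D] using h1
    exact ⟨⟨_, ge_of_tendsto' h2 fun n => NNReal.coe_nonneg _⟩, NNReal.tendsto_coe.1 h2⟩
  obtain ⟨d, hd⟩ := hDlim
  obtain ⟨K, hK⟩ := hd.bddAbove_range
  refine ⟨?_, l * d, ?_⟩
  · refine NNReal.summable_of_le (fun n => ?_) (hgs.mul_left K)
    calc g n ω = D (n + 1) ω * (g n ω / D (n + 1) ω) := (mul_div_cancel₀ _ (hD0 _ ω)).symm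
      _ ≤ _ := by
        gcongr
        exact hK (mem_range_self (n + 1))
  · exact (hl.mul hd).congr fun n => div_mul_cancel₀ _ (hD0 n ω)

end AlmostSupermartingale

end MonOp
namespace MonOp

section Blocks

variable {m : ℕ} {E : Fin m → Type*} [∀ i, NormedAddCommGroup (E i)] {B : ∀ i, PiLp 2 E → E i}

theorem continuous_of_continuous_blockMap (h : Continuous (blockMap B)) (i : Fin m) :
    Continuous (B i) :=
  (PiLp.continuous_apply 2 E i).comp h

theorem mem_solutions_iff {A : ∀ i, E i → Set (E i)} {z : PiLp 2 E} :
    z ∈ solutions A B ↔ ∀ i, -B i z ∈ A i (z i) := by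
  refine forall_congr' fun i => ?_
  simp only [Set.add_singleton, Set.mem_image]
  constructor
  · rintro ⟨u, hu, h⟩
    rwa [← eq_neg_of_add_eq_zero_left h]
  · exact fun h => ⟨_, h, neg_add_cancel _⟩

end Blocks

section ForwardBackward

variable {m : ℕ} {E : Fin m → Type*} [∀ i, NormedAddCommGroup (E i)]
  [∀ i, InnerProductSpace ℝ (E i)] {A : ∀ i, E i → Set (E i)} {B : ∀ i, PiLp 2 E → E i}

/-- The forward-backward operator on the Hilbert direct sum. -/
noncomputable def forwardBackward (A : ∀ i, E i → Set (E i)) (B : ∀ i, PiLp 2 E → E i) (γ : ℝ)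
    (x : PiLp 2 E) : PiLp 2 E :=
  WithLp.toLp 2 fun i => J (γ • A i) (x i - γ • B i x)

/-- `ϑ`-cocoercivity of an operator. -/
def Cocoercive {H : Type*} [NormedAddCommGroup H] [InnerProductSpace ℝ H] (ϑ : ℝ) (T : H → H) :
    Prop :=
  ∀ x y, ϑ * ‖T x - T y‖ ^ 2 ≤ ⟪x - y, T x - T y⟫

theorem Cocoercive.norm_sub_le {H : Type*} [NormedAddCommGroup H] [InnerProductSpace ℝ H] {ϑ : ℝ}
    {T : H → H} (hT : Cocoercive ϑ T) (hϑ : 0 < ϑ) (x y : H) :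
    ‖T x - T y‖ ≤ ϑ⁻¹ * ‖x - y‖ := by
  rw [inv_mul_eq_div, le_div_iff₀ hϑ, mul_comm]
  rcases (norm_nonneg (T x - T y)).eq_or_lt with h | h
  · rw [← h, mul_zero]; exact norm_nonneg _
  · refine le_of_mul_le_mul_right ?_ h
    calc ϑ * ‖T x - T y‖ * ‖T x - T y‖ = ϑ * ‖T x - T y‖ ^ 2 := by ring
      _ ≤ _ := (hT x y).trans (real_inner_le_norm _ _)

theorem Cocoercive.continuous {H : Type*} [NormedAddCommGroup H] [InnerProductSpace ℝ H] {ϑ : ℝ}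
    {T : H → H} (hT : Cocoercive ϑ T) (hϑ : 0 < ϑ) : Continuous T :=
  (LipschitzWith.of_dist_le_mul (K := ⟨ϑ⁻¹, (inv_pos.2 hϑ).le⟩) fun x y => by
    rw [dist_eq_norm, dist_eq_norm]; exact hT.norm_sub_le hϑ x y).continuous

theorem cocoercive_blockMap {ϑ : ℝ} (hB : ∀ x y : PiLp 2 E,
    ∑ i, ⟪x i - y i, B i x - B i y⟫ ≥ ϑ * ∑ i, ‖B i x - B i y‖ ^ 2) :
    Cocoercive ϑ (blockMap B) := by
  intro x y
  rw [PiLp.norm_sq_eq_of_L2, PiLp.inner_apply]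
  exact hB x y

variable [∀ i, CompleteSpace (E i)]

theorem smul_sub_forwardBackward_mem (hA : ∀ i, IsMaximallyMonotone (A i)) {γ : ℝ} (hγ : 0 < γ)
    (x : PiLp 2 E) (i : Fin m) :
    γ⁻¹ • (x i - γ • B i x - forwardBackward A B γ x i) ∈ A i (forwardBackward A B γ x i) :=
  (hA i).smul_sub_J_mem hγ _

/-- The basic inequality of the forward-backward operator at a solution. -/
theorem norm_forwardBackward_sub_sq_le (hA : ∀ i, IsMaximallyMonotone (A i)) {ϑ : ℝ}
    (hB : Cocoercive ϑ (blockMap B)) {γ : ℝ} (hγ : 0 < γ) {z : PiLp 2 E} (hz : z ∈ solutions A B)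
    (x : PiLp 2 E) :
    ‖forwardBackward A B γ x - z‖ ^ 2 + γ * (2 * ϑ - γ) * ‖blockMap B x - blockMap B z‖ ^ 2 +
      ‖x - forwardBackward A B γ x - γ • (blockMap B x - blockMap B z)‖ ^ 2 ≤ ‖x - z‖ ^ 2 := by
  have hi : ∀ i, ‖(forwardBackward A B γ x - z) i‖ ^ 2 +
      ‖(x - forwardBackward A B γ x - γ • (blockMap B x - blockMap B z)) i‖ ^ 2 ≤
      ‖((x - z) - γ • (blockMap B x - blockMap B z)) i‖ ^ 2 := by
    intro i
    have hz' : γ⁻¹ • ((z i - γ • B i z) - z i) ∈ A i (z i) := by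
      have : (z i - γ • B i z) - z i = γ • -B i z := by rw [smul_neg]; abel
      rw [this, inv_smul_smul₀ hγ.ne']
      exact mem_solutions_iff.1 hz i
    have h := (hA i).1.norm_sub_sq_add_le hγ (smul_sub_forwardBackward_mem (B := B) hA hγ x i) hz'
    have e1 : (x - forwardBackward A B γ x - γ • (blockMap B x - blockMap B z)) i =
        x i - γ • B i x - forwardBackward A B γ x i - (z i - γ • B i z - z i) := by
      simp only [PiLp.sub_apply, PiLp.smul_apply, blockMap, smul_sub]; abel
    have e2 : ((x - z) - γ • (blockMap B x - blockMap B z)) i =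
        x i - γ • B i x - (z i - γ • B i z) := by
      simp only [PiLp.sub_apply, PiLp.smul_apply, blockMap, smul_sub]; abel
    rw [e1, e2]
    exact h
  have hsum := Finset.sum_le_sum fun i (_ : i ∈ Finset.univ) => hi i
  rw [Finset.sum_add_distrib, ← PiLp.norm_sq_eq_of_L2, ← PiLp.norm_sq_eq_of_L2,
    ← PiLp.norm_sq_eq_of_L2, norm_sub_sq_real (x - z), real_inner_smul_right, norm_smul,
    mul_pow, Real.norm_eq_abs, sq_abs] at hsum
  have := mul_le_mul_of_nonneg_left (hB x z) hγ.le
  linarith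

/-- The blockwise relaxed forward-backward step at a solution. -/
theorem sum_norm_relaxed_sq_le (hA : ∀ i, IsMaximallyMonotone (A i)) {ϑ : ℝ}
    (hB : Cocoercive ϑ (blockMap B)) {γ : ℝ} (hγ : 0 < γ) {z : PiLp 2 E} (hz : z ∈ solutions A B)
    {l : ℝ} (hl : l ∈ Ioc (0 : ℝ) 1) (x : PiLp 2 E) :
    ∑ i, ‖x i + l • (forwardBackward A B γ x i - x i) - z i‖ ^ 2 +
      l * (γ * (2 * ϑ - γ) * ‖blockMap B x - blockMap B z‖ ^ 2 +
        ‖x - forwardBackward A B γ x - γ • (blockMap B x - blockMap B z)‖ ^ 2) ≤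
      ∑ i, ‖x i - z i‖ ^ 2 := by
  have hi : ∀ i, ‖x i + l • (forwardBackward A B γ x i - x i) - z i‖ ^ 2 ≤
      (1 - l) * ‖(x - z) i‖ ^ 2 + l * ‖(forwardBackward A B γ x - z) i‖ ^ 2 := by
    intro i
    have e : x i + l • (forwardBackward A B γ x i - x i) - z i =
        (1 - l) • (x - z) i + l • (forwardBackward A B γ x - z) i := by
      simp only [PiLp.sub_apply, smul_sub, sub_smul, one_smul]; abel
    have hc : ‖(1 - l) • (x - z) i + l • (forwardBackward A B γ x - z) i‖ ≤
        (1 - l) * ‖(x - z) i‖ + l * ‖(forwardBackward A B γ x - z) i‖ := by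
      refine (norm_add_le _ _).trans_eq ?_
      rw [norm_smul, norm_smul, Real.norm_of_nonneg (sub_nonneg.2 hl.2), Real.norm_of_nonneg hl.1.le]
    rw [e]
    refine (pow_le_pow_left₀ (norm_nonneg _) hc 2).trans ?_
    have := mul_nonneg (mul_nonneg hl.1.le (sub_nonneg.2 hl.2))
      (sq_nonneg (‖(x - z) i‖ - ‖(forwardBackward A B γ x - z) i‖))
    linarith
  have hsum := Finset.sum_le_sum fun i (_ : i ∈ Finset.univ) => hi i
  rw [Finset.sum_add_distrib, ← Finset.mul_sum, ← Finset.mul_sum, ← PiLp.norm_sq_eq_of_L2,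
    ← PiLp.norm_sq_eq_of_L2] at hsum
  have hx : ∑ i, ‖x i - z i‖ ^ 2 = ‖x - z‖ ^ 2 := by
    rw [PiLp.norm_sq_eq_of_L2]; rfl
  rw [hx]
  have := mul_le_mul_of_nonneg_left (norm_forwardBackward_sub_sq_le hA hB hγ hz x) hl.1.le
  linarith

theorem norm_J_perturbed_sub_le (hA : ∀ i, IsMaximallyMonotone (A i)) {γ : ℝ} (hγ : 0 < γ)
    (x c : PiLp 2 E) (i : Fin m) :
    ‖J (γ • A i) (x i - γ • (B i x + c i)) - forwardBackward A B γ x i‖ ≤ γ * ‖c i‖ := by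
  refine ((hA i).norm_J_sub_le hγ _ _).trans_eq ?_
  have : x i - γ • (B i x + c i) - (x i - γ • B i x) = -(γ • c i) := by rw [smul_add]; abel
  rw [this, norm_neg, norm_smul, Real.norm_of_nonneg hγ.le]

theorem continuous_forwardBackward (hA : ∀ i, IsMaximallyMonotone (A i))
    (hB : Continuous (blockMap B)) {γ : ℝ} (hγ : 0 < γ) :
    Continuous (forwardBackward A B γ) :=
  (PiLp.continuous_toLp 2 E).comp <| continuous_pi fun i => ((hA i).continuous_J hγ).comp <|
    (PiLp.continuous_apply 2 E i).sub ((continuous_of_continuous_blockMap hB i).const_smul γ)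

end ForwardBackward

section ConditionalSteps

open scoped NNReal

theorem nnnorm_add_sq_le {H : Type*} [SeminormedAddCommGroup H] (u v : H) {ξ : ℝ≥0} (hξ : ξ ≠ 0) :
    ‖u + v‖₊ ^ 2 ≤ (1 + ξ) * ‖u‖₊ ^ 2 + (1 + ξ⁻¹) * ‖v‖₊ ^ 2 := by
  rw [← NNReal.coe_le_coe]
  push_cast
  have hξ' : (0 : ℝ) < ξ := NNReal.coe_pos.2 (pos_iff_ne_zero.2 hξ)
  refine (pow_le_pow_left₀ (norm_nonneg _) (norm_add_le u v) 2).trans ?_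
  have h1 : 0 ≤ (ξ : ℝ)⁻¹ * (ξ * ‖u‖ - ‖v‖) ^ 2 := by positivity
  have h2 : (ξ : ℝ)⁻¹ * (ξ * ‖u‖ - ‖v‖) ^ 2 =
      ξ * ‖u‖ ^ 2 - 2 * (‖u‖ * ‖v‖) + (ξ : ℝ)⁻¹ * ‖v‖ ^ 2 := by
    field_simp
    ring
  linarith

variable {Ω : Type*} {𝒳 mΩ : MeasurableSpace Ω} {P : Measure Ω}

theorem lintegral_mul_condLExp (h𝒳 : 𝒳 ≤ mΩ) [SigmaFinite (P.trim h𝒳)] {X h : Ω → ℝ≥0∞}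
    (hX : Measurable X) (hh : Measurable[𝒳] h) :
    ∫⁻ ω, h ω * condLExp 𝒳 P X ω ∂P = ∫⁻ ω, h ω * X ω ∂P := by
  have hc : Measurable (condLExp 𝒳 P X) := (measurable_condLExp 𝒳 P X).mono h𝒳 le_rfl
  have hh' : Measurable h := hh.mono h𝒳 le_rfl
  have heq : (P.withDensity (condLExp 𝒳 P X)).trim h𝒳 = (P.withDensity X).trim h𝒳 := by
    refine @Measure.ext _ 𝒳 _ _ fun s hs => ?_
    rw [trim_measurableSet_eq h𝒳 hs, trim_measurableSet_eq h𝒳 hs, withDensity_apply _ (h𝒳 s hs),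
      withDensity_apply _ (h𝒳 s hs), setLIntegral_condLExp h𝒳 P X hs]
  have h1 : ∀ {Y : Ω → ℝ≥0∞}, Measurable Y →
      ∫⁻ ω, h ω * Y ω ∂P = ∫⁻ ω, h ω ∂(P.withDensity Y).trim h𝒳 := by
    intro Y hY
    rw [lintegral_trim h𝒳 hh, lintegral_withDensity_eq_lintegral_mul _ hY hh']
    simp [mul_comm]
  rw [h1 hc, h1 hX, heq]

theorem setLIntegral_of_indep {ℰ : MeasurableSpace Ω} (hℰ : ℰ ≤ mΩ) (h𝒳 : 𝒳 ≤ mΩ)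
    (hind : Indep ℰ 𝒳 P) {S : Set Ω} (hS : MeasurableSet[ℰ] S) {f : Ω → ℝ≥0∞}
    (hf : Measurable[𝒳] f) : ∫⁻ ω in S, f ω ∂P = P S * ∫⁻ ω, f ω ∂P := by
  have h := lintegral_mul_eq_lintegral_mul_lintegral_of_independent_measurableSpace hℰ h𝒳 hind
    (f := S.indicator 1) (g := f) (measurable_one.indicator hS) hf
  rw [lintegral_indicator_one (hℰ S hS)] at h
  rw [← h, ← lintegral_indicator (hℰ S hS)]
  refine lintegral_congr fun ω => ?_
  by_cases hω : ω ∈ S <;> simp [hω]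

/-- Random activation of blocks: if replacing each `Fᵢ` by `Gᵢ` decreases the plain sum by `g`, then
activating each replacement on an independent event, with weights that compensate for the activation
probabilities, decreases the weighted sum by `g` in conditional mean. -/
theorem lintegral_random_activation {ι : Type*} [Fintype ι] (h𝒳 : 𝒳 ≤ mΩ) {S : ι → Set Ω}
    (hSm : ∀ i, MeasurableSet (S i))
    (hS : ∀ i, ∀ f : Ω → ℝ≥0∞, Measurable[𝒳] f → ∫⁻ ω in S i, f ω ∂P = P (S i) * ∫⁻ ω, f ω ∂P)
    {w : ι → ℝ≥0∞} (hw : ∀ i, w i * P (S i) = 1) {F G : ι → Ω → ℝ≥0∞} {g h : Ω → ℝ≥0∞}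
    (hF : ∀ i, Measurable[𝒳] (F i)) (hG : ∀ i, Measurable[𝒳] (G i)) (hg : Measurable[𝒳] g)
    (hh : Measurable[𝒳] h) (hle : ∀ ω, ∑ i, G i ω + g ω ≤ ∑ i, F i ω) :
    ∫⁻ ω, h ω * (∑ i, w i * ((S i).indicator (G i) ω + (S i)ᶜ.indicator (F i) ω) + g ω) ∂P ≤
      ∫⁻ ω, h ω * ∑ i, w i * F i ω ∂P := by
  have up : ∀ {f : Ω → ℝ≥0∞}, Measurable[𝒳] f → Measurable f := fun hf => hf.mono h𝒳 le_rfl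
  have hFG : ∀ i, Measurable fun ω => (S i).indicator (G i) ω + (S i)ᶜ.indicator (F i) ω :=
    fun i => ((up (hG i)).indicator (hSm i)).add ((up (hF i)).indicator (hSm i).compl)
  have mulm : ∀ {f : Ω → ℝ≥0∞}, Measurable f → Measurable fun ω => h ω * f ω :=
    fun hf => (up hh).mul hf
  have hone : ∀ i, ∀ {f : Ω → ℝ≥0∞}, Measurable[𝒳] f →
      w i * ∫⁻ ω in S i, h ω * f ω ∂P = ∫⁻ ω, h ω * f ω ∂P := by
    intro i f hf
    rw [hS i (fun ω => h ω * f ω) (hh.mul hf), ← mul_assoc, hw, one_mul]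
  have hl : ∀ i, ∫⁻ ω, h ω * (w i * ((S i).indicator (G i) ω + (S i)ᶜ.indicator (F i) ω)) ∂P =
      ∫⁻ ω, h ω * G i ω ∂P + w i * ∫⁻ ω in (S i)ᶜ, h ω * F i ω ∂P := by
    intro i
    have e : ∀ ω, h ω * (w i * ((S i).indicator (G i) ω + (S i)ᶜ.indicator (F i) ω)) =
        w i * ((S i).indicator (fun ω => h ω * G i ω) ω +
          (S i)ᶜ.indicator (fun ω => h ω * F i ω) ω) := by
      intro ω
      by_cases hω : ω ∈ S i <;> simp [hω, mul_left_comm]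
    have hm : Measurable fun ω => (S i).indicator (fun ω => h ω * G i ω) ω +
        (S i)ᶜ.indicator (fun ω => h ω * F i ω) ω :=
      ((mulm (up (hG i))).indicator (hSm i)).add ((mulm (up (hF i))).indicator (hSm i).compl)
    simp only [e]
    rw [lintegral_const_mul _ hm, lintegral_add_left ((mulm (up (hG i))).indicator (hSm i)),
      lintegral_indicator (hSm i), lintegral_indicator (hSm i).compl, mul_add, hone i (hG i)]
  have hr : ∀ i, ∫⁻ ω, h ω * (w i * F i ω) ∂P =
      ∫⁻ ω, h ω * F i ω ∂P + w i * ∫⁻ ω in (S i)ᶜ, h ω * F i ω ∂P := by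
    intro i
    simp only [mul_left_comm (h _)]
    rw [lintegral_const_mul _ (mulm (up (hF i))),
      ← lintegral_add_compl (fun ω => h ω * F i ω) (hSm i), mul_add, hone i (hF i),
      lintegral_add_compl _ (hSm i)]
  simp only [mul_add (h _), Finset.mul_sum]
  rw [lintegral_add_right _ (mulm (up hg)),
    lintegral_finsetSum _ fun i _ => mulm ((hFG i).const_mul _),
    lintegral_finsetSum _ fun i _ => mulm ((up (hF i)).const_mul _)]
  simp only [hl, hr, Finset.sum_add_distrib]
  rw [add_right_comm]
  refine add_le_add ?_ le_rfl
  rw [← lintegral_finsetSum _ fun i _ => mulm (up (hG i)),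
    ← lintegral_finsetSum _ fun i _ => mulm (up (hF i)),
    ← lintegral_add_right _ (mulm (up hg))]
  refine lintegral_mono fun ω => ?_
  simp only [← Finset.mul_sum, ← mul_add]
  exact mul_le_mul_right (hle ω) (h ω)

end ConditionalSteps

end MonOp
namespace MonOp

section Iteration

open scoped NNReal

theorem measurable_history {Ω X : Type*} [MeasurableSpace X] (x : ℕ → Ω → X) (n : ℕ) :
    Measurable[history x n] (x n) :=
  (comap_measurable (x n)).mono (le_iSup₂_of_le n (Finset.self_mem_range_succ n) le_rfl) le_rfl

variable {Ω : Type*} [mΩ : MeasurableSpace Ω]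

/-- The filtration of the histories of a process. -/
def historyFiltration {X : Type*} [MeasurableSpace X] (x : ℕ → Ω → X)
    (hx : ∀ n, Measurable (x n)) : Filtration ℕ mΩ where
  seq := history x
  mono' _ _ hij := biSup_mono fun _ hk =>
    Finset.mem_range.2 ((Finset.mem_range.1 hk).trans_le (Nat.succ_le_succ hij))
  le' _ := iSup₂_le fun k _ => (hx k).comap_le

/-- The square root of the conditional second moments of the errors, made finite and positive by
adding a summable sequence. -/
noncomputable def errorScale {X : Type*} [NormedAddCommGroup X] (P : Measure Ω)
    (𝒳 : ℕ → MeasurableSpace Ω) (a c : ℕ → Ω → X) (n : ℕ) (ω : Ω) : ℝ≥0 :=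
  ((condLExp (𝒳 n) P (fun ω' => ‖a n ω'‖ₑ ^ 2) ω) ^ (1 / 2 : ℝ)).toNNReal +
    ((condLExp (𝒳 n) P (fun ω' => ‖c n ω'‖ₑ ^ 2) ω) ^ (1 / 2 : ℝ)).toNNReal + 2⁻¹ ^ n

section ErrorScale

variable {X : Type*} [NormedAddCommGroup X] (P : Measure Ω) (𝒳 : ℕ → MeasurableSpace Ω)
  (a c : ℕ → Ω → X)

theorem errorScale_ne_zero (n : ℕ) (ω : Ω) : errorScale P 𝒳 a c n ω ≠ 0 := by
  have : (0 : ℝ≥0) < 2⁻¹ ^ n := by positivity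
  exact (this.trans_le le_add_self).ne'

theorem measurable_errorScale (n : ℕ) : Measurable[𝒳 n] (errorScale P 𝒳 a c n) := by
  have h : ∀ e : ℕ → Ω → X, Measurable[𝒳 n] fun ω =>
      ((condLExp (𝒳 n) P (fun ω' => ‖e n ω'‖ₑ ^ 2) ω) ^ (1 / 2 : ℝ)).toNNReal := fun e =>
    ((measurable_condLExp (𝒳 n) P _).pow_const _).ennreal_toNNReal
  exact ((h a).add (h c)).add measurable_const

variable {P 𝒳 a c}

theorem SummableCondErrors.ae_ne_top (h : SummableCondErrors P 𝒳 a) :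
    ∀ᵐ ω ∂P, ∀ n, (condLExp (𝒳 n) P (fun ω' => ‖a n ω'‖ₑ ^ 2) ω) ^ (1 / 2 : ℝ) ≠ ∞ := by
  filter_upwards [h] with ω hω n
  exact ENNReal.ne_top_of_tsum_ne_top hω.ne n

theorem SummableCondErrors.ae_summable (h : SummableCondErrors P 𝒳 a) :
    ∀ᵐ ω ∂P, Summable fun n =>
      ((condLExp (𝒳 n) P (fun ω' => ‖a n ω'‖ₑ ^ 2) ω) ^ (1 / 2 : ℝ)).toNNReal := by
  filter_upwards [h, h.ae_ne_top] with ω hω hne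
  rw [← ENNReal.tsum_coe_ne_top_iff_summable]
  simpa only [ENNReal.coe_toNNReal (hne _)] using hω.ne

theorem summable_errorScale (ha : SummableCondErrors P 𝒳 a) (hc : SummableCondErrors P 𝒳 c) :
    ∀ᵐ ω ∂P, Summable fun n => errorScale P 𝒳 a c n ω := by
  filter_upwards [ha.ae_summable, hc.ae_summable] with ω h1 h2
  refine (h1.add h2).add ?_
  rw [← NNReal.summable_coe]
  simpa using summable_geometric_two

theorem condLExp_add_le_errorScale_sq (ha : SummableCondErrors P 𝒳 a)
    (hc : SummableCondErrors P 𝒳 c) (n : ℕ) :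
    ∀ᵐ ω ∂P, condLExp (𝒳 n) P (fun ω' => ‖a n ω'‖ₑ ^ 2) ω +
      condLExp (𝒳 n) P (fun ω' => ‖c n ω'‖ₑ ^ 2) ω ≤ ((errorScale P 𝒳 a c n ω ^ 2 : ℝ≥0) : ℝ≥0∞) := by
  filter_upwards [ha.ae_ne_top, hc.ae_ne_top] with ω h1 h2
  have hsq : ∀ t : ℝ≥0∞, t ^ (1 / 2 : ℝ) ≠ ∞ → t = (((t ^ (1 / 2 : ℝ)).toNNReal ^ 2 : ℝ≥0) : ℝ≥0∞) := by
    intro t ht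
    rw [ENNReal.coe_pow, ENNReal.coe_toNNReal ht, ← ENNReal.rpow_natCast, ← ENNReal.rpow_mul]
    norm_num
  rw [hsq _ (h1 n), hsq _ (h2 n), ← ENNReal.coe_add, ENNReal.coe_le_coe]
  refine le_trans ?_ (pow_le_pow_left₀ zero_le
    (le_self_add : _ ≤ errorScale P 𝒳 a c n ω) 2)
  rw [add_sq]
  exact add_le_add le_self_add le_rfl

end ErrorScale

variable {m : ℕ} {E : Fin m → Type*} [∀ i, NormedAddCommGroup (E i)]
  [∀ i, InnerProductSpace ℝ (E i)]
  [∀ i, MeasurableSpace (E i)]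

/-- The data of the random block-coordinate forward-backward iteration; `δ` is a lower bound for the
relaxation parameters and for the coefficients of the residuals. -/
structure RandomForwardBackward (P : Measure Ω) (A : ∀ i, E i → Set (E i))
    (B : ∀ i, PiLp 2 E → E i) (ϑ : ℝ) (δ : ℝ≥0) (γ lam : ℕ → ℝ) (x a c : ℕ → Ω → PiLp 2 E)
    (ε : ℕ → Ω → Fin m → ℝ) : Prop where
  maximallyMonotone : ∀ i, IsMaximallyMonotone (A i)
  ϑ_pos : 0 < ϑ
  cocoercive : Cocoercive ϑ (blockMap B)
  δ_pos : 0 < δ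
  γ_mem : ∀ n, γ n ∈ Ioo 0 (2 * ϑ)
  lam_mem : ∀ n, lam n ∈ Ioc (0 : ℝ) 1
  δ_le_lam : ∀ n, (δ : ℝ) ≤ lam n
  δ_le_gain : ∀ n, (δ : ℝ) ≤ lam n * (γ n * (2 * ϑ - γ n))
  measurable_iterate : ∀ n, Measurable (x n)
  measurable_a : ∀ n, Measurable (a n)
  measurable_c : ∀ n, Measurable (c n)
  measurable_ε : ∀ n, Measurable (ε n)
  ε_eq : ∀ n ω i, ε n ω i = 0 ∨ ε n ω i = 1
  step : ∀ n ω i, x (n + 1) ω i = x n ω i + (ε n ω i * lam n) •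
      (J (γ n • A i) (x n ω i - γ n • (B i (x n ω) + c n ω i)) + a n ω i - x n ω i)
  summable_a : SummableCondErrors P (history x) a
  summable_c : SummableCondErrors P (history x) c
  indep : ∀ n, Indep (MeasurableSpace.comap (ε n) inferInstance) (history x n) P
  prob_eq : ∀ n i, P {ω | ε n ω i = 1} = P {ω | ε 0 ω i = 1}
  prob_pos : ∀ i, 0 < P {ω | ε 0 ω i = 1}

/-- The squared residual of the forward-backward operator with respect to a solution `z`. -/
noncomputable def residual (A : ∀ i, E i → Set (E i)) (B : ∀ i, PiLp 2 E → E i) (γ : ℝ)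
    (z x : PiLp 2 E) : ℝ≥0 :=
  ‖blockMap B x - blockMap B z‖₊ ^ 2 +
    ‖x - forwardBackward A B γ x - γ • (blockMap B x - blockMap B z)‖₊ ^ 2

/-- The squared norm of the direct sum with reweighted blocks. -/
noncomputable def weightedNormSq (w : Fin m → ℝ≥0) (x : PiLp 2 E) : ℝ≥0 :=
  ∑ i, w i * ‖x i‖₊ ^ 2

/-- The weights that compensate for the activation probabilities. -/
noncomputable def activationWeight (P : Measure Ω) (ε : Ω → Fin m → ℝ) (i : Fin m) : ℝ≥0 :=
  (P {ω | ε ω i = 1})⁻¹.toNNReal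

namespace RandomForwardBackward

variable {P : Measure Ω} {A : ∀ i, E i → Set (E i)}
    {B : ∀ i, PiLp 2 E → E i} {ϑ : ℝ} {δ : ℝ≥0} {γ lam : ℕ → ℝ} {x a c : ℕ → Ω → PiLp 2 E}
    {ε : ℕ → Ω → Fin m → ℝ}

theorem coe_activationWeight (H : RandomForwardBackward P A B ϑ δ γ lam x a c ε) (i : Fin m) :
    (activationWeight P (ε 0) i : ℝ≥0∞) = (P {ω | ε 0 ω i = 1})⁻¹ :=
  ENNReal.coe_toNNReal (ENNReal.inv_ne_top.2 (H.prob_pos i).ne')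

theorem activationWeight_mul [IsProbabilityMeasure P]
    (H : RandomForwardBackward P A B ϑ δ γ lam x a c ε) (n : ℕ) (i : Fin m) :
    (activationWeight P (ε 0) i : ℝ≥0∞) * P {ω | ε n ω i = 1} = 1 := by
  rw [H.coe_activationWeight, H.prob_eq n i]
  exact ENNReal.inv_mul_cancel (H.prob_pos i).ne' (measure_ne_top _ _)

theorem activationWeight_pos [IsProbabilityMeasure P]
    (H : RandomForwardBackward P A B ϑ δ γ lam x a c ε) (i : Fin m) :
    0 < activationWeight P (ε 0) i := by
  rw [pos_iff_ne_zero, ← ENNReal.coe_ne_zero, H.coe_activationWeight]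
  exact ENNReal.inv_ne_zero.2 (measure_ne_top _ _)

theorem γ_bounds (H : RandomForwardBackward P A B ϑ δ γ lam x a c ε) (n : ℕ) :
    γ n ∈ Icc ((δ : ℝ) / (2 * ϑ)) (2 * ϑ) := by
  have hγ := H.γ_mem n
  have hl := H.lam_mem n
  have hϑ := H.ϑ_pos
  refine ⟨?_, hγ.2.le⟩
  rw [div_le_iff₀ (by linarith)]
  refine (H.δ_le_gain n).trans ?_
  have h1 : 0 < γ n * (2 * ϑ - γ n) := mul_pos hγ.1 (by linarith [hγ.2])
  refine (mul_le_of_le_one_left h1.le hl.2).trans ?_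
  have := hγ.1.le
  gcongr
  linarith

variable [∀ i, CompleteSpace (E i)]

/-- The unperturbed update decreases the sum of the squared distances to a solution. -/
theorem sum_relaxed_add_le (H : RandomForwardBackward P A B ϑ δ γ lam x a c ε)
    {z : PiLp 2 E} (hz : z ∈ solutions A B) (n : ℕ) (y : PiLp 2 E) :
    ∑ i, ‖y i + lam n • (forwardBackward A B (γ n) y i - y i) - z i‖₊ ^ 2 +
      δ * residual A B (γ n) z y ≤ ∑ i, ‖y i - z i‖₊ ^ 2 := by
  have h := sum_norm_relaxed_sq_le H.maximallyMonotone H.cocoercive (H.γ_mem n).1 hz (H.lam_mem n) y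
  rw [← NNReal.coe_le_coe]
  simp only [residual]
  push_cast
  refine le_trans (add_le_add le_rfl ?_) h
  rw [mul_add, mul_add, ← mul_assoc]
  gcongr
  · exact H.δ_le_gain n
  · exact H.δ_le_lam n

/-- The update of a block, split into the unperturbed update and the errors. -/
theorem nnnorm_step_sq_le (H : RandomForwardBackward P A B ϑ δ γ lam x a c ε) (z : PiLp 2 E)
    (n : ℕ) (ω : Ω) (i : Fin m) {ξ : ℝ≥0} (hξ : ξ ≠ 0) :
    ‖x (n + 1) ω i - z i‖₊ ^ 2 ≤ (1 + ξ) *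
      (({ω | ε n ω i = 1}.indicator (fun ω => ‖x n ω i +
          lam n • (forwardBackward A B (γ n) (x n ω) i - x n ω i) - z i‖₊ ^ 2) ω) +
        ({ω | ε n ω i = 1}ᶜ.indicator (fun ω => ‖x n ω i - z i‖₊ ^ 2) ω)) +
      (1 + ξ⁻¹) * ((2 + 8 * ϑ.toNNReal ^ 2) * (‖a n ω‖₊ ^ 2 + ‖c n ω‖₊ ^ 2)) := by
  set T := forwardBackward A B (γ n) (x n ω) i with hT
  set t := J (γ n • A i) (x n ω i - γ n • (B i (x n ω) + c n ω i)) with ht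
  have hsplit : x (n + 1) ω i - z i =
      (x n ω i + (ε n ω i * lam n) • (T - x n ω i) - z i) +
        (ε n ω i * lam n) • ((t - T) + a n ω i) := by
    rw [H.step n ω i]
    have : t + a n ω i - x n ω i = (T - x n ω i) + ((t - T) + a n ω i) := by abel
    rw [← ht, this, smul_add]; abel
  rw [hsplit]
  refine (nnnorm_add_sq_le _ _ hξ).trans (add_le_add (mul_le_mul_right (le_of_eq ?_) _)
    (mul_le_mul_right ?_ _))
  · rcases H.ε_eq n ω i with h | h
    · simp [h]
    · simp [h, hT]
  · rw [← NNReal.coe_le_coe]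
    push_cast
    rw [Real.coe_toNNReal _ H.ϑ_pos.le]
    have hel : |ε n ω i * lam n| ≤ 1 := by
      have := H.lam_mem n
      rcases H.ε_eq n ω i with h | h
      · simp [h]
      · rw [h, one_mul, abs_of_pos this.1]; exact this.2
    have hγ := H.γ_mem n
    have h1 : ‖(ε n ω i * lam n) • ((t - T) + a n ω i)‖ ≤ 2 * ϑ * ‖c n ω‖ + ‖a n ω‖ := by
      rw [norm_smul, Real.norm_eq_abs]
      refine (mul_le_of_le_one_left (norm_nonneg _) hel).trans ((norm_add_le _ _).trans ?_)
      refine add_le_add ((norm_J_perturbed_sub_le H.maximallyMonotone hγ.1 _ _ i).trans ?_)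
        (PiLp.norm_apply_le _ i)
      exact mul_le_mul hγ.2.le (PiLp.norm_apply_le _ i) (norm_nonneg _) (by linarith [H.ϑ_pos])
    refine (pow_le_pow_left₀ (norm_nonneg _) h1 2).trans ?_
    nlinarith [sq_nonneg (2 * ϑ * ‖c n ω‖ - ‖a n ω‖), sq_nonneg ‖c n ω‖, sq_nonneg (ϑ * ‖a n ω‖)]

theorem weightedNormSq_step_le (H : RandomForwardBackward P A B ϑ δ γ lam x a c ε) (z : PiLp 2 E)
    (w : Fin m → ℝ≥0) (n : ℕ) (ω : Ω) {ξ : ℝ≥0} (hξ : ξ ≠ 0) :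
    weightedNormSq w (x (n + 1) ω - z) ≤ (1 + ξ) *
      ∑ i, w i * (({ω | ε n ω i = 1}.indicator (fun ω => ‖x n ω i +
          lam n • (forwardBackward A B (γ n) (x n ω) i - x n ω i) - z i‖₊ ^ 2) ω) +
        ({ω | ε n ω i = 1}ᶜ.indicator (fun ω => ‖x n ω i - z i‖₊ ^ 2) ω)) +
      (∑ i, w i) * (2 + 8 * ϑ.toNNReal ^ 2) * ((1 + ξ⁻¹) * (‖a n ω‖₊ ^ 2 + ‖c n ω‖₊ ^ 2)) := by
  refine (Finset.sum_le_sum fun i _ => mul_le_mul_right (H.nnnorm_step_sq_le z n ω i hξ)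
    (w i)).trans_eq ?_
  rw [Finset.mul_sum, Finset.sum_mul, Finset.sum_mul, ← Finset.sum_add_distrib]
  exact Finset.sum_congr rfl fun i _ => by ring

variable [∀ i, TopologicalSpace.SeparableSpace (E i)] [∀ i, BorelSpace (E i)]
  [IsProbabilityMeasure P]

/-- The conditional quasi-Fejér inequality, in integrated form. -/
theorem lintegral_quasiFejer (H : RandomForwardBackward P A B ϑ δ γ lam x a c ε)
    {z : PiLp 2 E} (hz : z ∈ solutions A B) (n : ℕ) {h : Ω → ℝ≥0}
    (hh : Measurable[history x n] h) :
    ∫⁻ ω, h ω * (weightedNormSq (activationWeight P (ε 0)) (x (n + 1) ω - z) +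
        (δ * residual A B (γ n) z (x n ω) : ℝ≥0)) ∂P ≤
      ∫⁻ ω, h ω * ((1 + errorScale P (history x) a c n ω) *
        weightedNormSq (activationWeight P (ε 0)) (x n ω - z) +
          ((∑ i, activationWeight P (ε 0) i) * (2 + 8 * ϑ.toNNReal ^ 2) *
            (errorScale P (history x) a c n ω * (1 + errorScale P (history x) a c n ω)) : ℝ≥0)) ∂P := by
  have : BorelSpace (PiLp 2 E) := borelSpace_directSum
  have hsec : ∀ i, SecondCountableTopology (E i) := fun i =>
    UniformSpace.secondCountable_of_separable (E i)
  set w := activationWeight P (ε 0) with hw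
  set ξ := errorScale P (history x) a c n with hξ
  set K := (∑ i, w i) * (2 + 8 * ϑ.toNNReal ^ 2) with hK
  have hle := (historyFiltration x H.measurable_iterate).le n
  change history x n ≤ mΩ at hle
  have hxm := measurable_history x n
  have hξm : Measurable[history x n] ξ := measurable_errorScale P (history x) a c n
  have hBc := H.cocoercive.continuous H.ϑ_pos
  have hTc := continuous_forwardBackward H.maximallyMonotone hBc (H.γ_mem n).1
  have happ : ∀ i, Continuous fun y : PiLp 2 E => y i := fun i => PiLp.continuous_apply 2 E i
  have hFm : ∀ i, Measurable[history x n] fun ω => ‖x n ω i - z i‖₊ ^ 2 := fun i => by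
    have : Continuous fun y : PiLp 2 E => ‖y i - z i‖₊ ^ 2 := by fun_prop
    exact this.measurable.comp hxm
  have hGm : ∀ i, Measurable[history x n] fun ω => ‖x n ω i +
      lam n • (forwardBackward A B (γ n) (x n ω) i - x n ω i) - z i‖₊ ^ 2 := fun i => by
    have hTi : Continuous fun y => forwardBackward A B (γ n) y i := (happ i).comp hTc
    have : Continuous fun y : PiLp 2 E =>
        ‖y i + lam n • (forwardBackward A B (γ n) y i - y i) - z i‖₊ ^ 2 :=
      ((((happ i).add ((hTi.sub (happ i)).const_smul _)).sub continuous_const).nnnorm).pow 2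
    exact this.measurable.comp hxm
  have hgm : Measurable[history x n] fun ω => δ * residual A B (γ n) z (x n ω) := by
    have : Continuous fun y : PiLp 2 E => δ * residual A B (γ n) z y := by
      unfold residual; fun_prop
    exact this.measurable.comp hxm
  have hSm' : ∀ i, MeasurableSet[MeasurableSpace.comap (ε n) inferInstance] {ω | ε n ω i = 1} :=
    fun i => ⟨{d | d i = 1}, measurable_pi_apply i (measurableSet_singleton 1), rfl⟩
  have hcomap := (H.measurable_ε n).comap_le
  have hSm : ∀ i, MeasurableSet {ω | ε n ω i = 1} := fun i => hcomap _ (hSm' i)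
  set Y : Ω → ℝ≥0 := fun ω => ∑ i, w i * (({ω | ε n ω i = 1}.indicator (fun ω => ‖x n ω i +
          lam n • (forwardBackward A B (γ n) (x n ω) i - x n ω i) - z i‖₊ ^ 2) ω) +
        ({ω | ε n ω i = 1}ᶜ.indicator (fun ω => ‖x n ω i - z i‖₊ ^ 2) ω)) with hY
  set g : Ω → ℝ≥0 := fun ω => δ * residual A B (γ n) z (x n ω) with hg
  have hact := lintegral_random_activation (P := P) hle hSm
    (fun i f hf => setLIntegral_of_indep hcomap hle (H.indep n) (hSm' i) hf)
    (w := fun i => (w i : ℝ≥0∞)) (H.activationWeight_mul n)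
    (F := fun i ω => ((‖x n ω i - z i‖₊ ^ 2 : ℝ≥0) : ℝ≥0∞))
    (G := fun i ω => ((‖x n ω i + lam n • (forwardBackward A B (γ n) (x n ω) i - x n ω i) -
      z i‖₊ ^ 2 : ℝ≥0) : ℝ≥0∞)) (g := fun ω => (g ω : ℝ≥0∞))
    (h := fun ω => ((h ω * (1 + ξ ω) : ℝ≥0) : ℝ≥0∞))
    (fun i => (hFm i).coe_nnreal_ennreal) (fun i => (hGm i).coe_nnreal_ennreal)
    hgm.coe_nnreal_ennreal (hh.mul (measurable_const.add hξm)).coe_nnreal_ennreal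
    (fun ω => by exact_mod_cast H.sum_relaxed_add_le hz n (x n ω))
  have hYcoe : ∀ ω, ∑ i, (w i : ℝ≥0∞) * ({ω | ε n ω i = 1}.indicator (fun ω =>
        ((‖x n ω i + lam n • (forwardBackward A B (γ n) (x n ω) i - x n ω i) -
          z i‖₊ ^ 2 : ℝ≥0) : ℝ≥0∞)) ω +
      {ω | ε n ω i = 1}ᶜ.indicator (fun ω => ((‖x n ω i - z i‖₊ ^ 2 : ℝ≥0) : ℝ≥0∞)) ω) = Y ω := by
    intro ω
    simp only [hY, ENNReal.ofNNReal_finsetSum, ENNReal.coe_mul, ENNReal.coe_add, ENNReal.coe_indicator]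
  simp only [hYcoe] at hact
  have hcond : ∫⁻ ω, ((h ω * (1 + (ξ ω)⁻¹) : ℝ≥0) : ℝ≥0∞) * (‖a n ω‖ₑ ^ 2 + ‖c n ω‖ₑ ^ 2) ∂P ≤
      ∫⁻ ω, ((h ω * (ξ ω * (1 + ξ ω)) : ℝ≥0) : ℝ≥0∞) ∂P := by
    have ham : Measurable fun ω => ‖a n ω‖ₑ ^ 2 := ((H.measurable_a n).enorm).pow_const 2
    have hcm : Measurable fun ω => ‖c n ω‖ₑ ^ 2 := ((H.measurable_c n).enorm).pow_const 2
    set k : Ω → ℝ≥0∞ := fun ω => ((h ω * (1 + (ξ ω)⁻¹) : ℝ≥0) : ℝ≥0∞) with hkdef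
    have hk : Measurable[history x n] k :=
      (hh.mul (measurable_const.add hξm.inv)).coe_nnreal_ennreal
    have hka : Measurable fun ω => k ω * ‖a n ω‖ₑ ^ 2 := (hk.mono hle le_rfl).mul ham
    have hkca : Measurable fun ω =>
        k ω * condLExp (history x n) P (fun ω => ‖a n ω‖ₑ ^ 2) ω := (hk.mono hle le_rfl).mul
      ((measurable_condLExp (history x n) P fun ω => ‖a n ω‖ₑ ^ 2).mono hle le_rfl)
    change ∫⁻ ω, k ω * (‖a n ω‖ₑ ^ 2 + ‖c n ω‖ₑ ^ 2) ∂P ≤ _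
    simp only [mul_add (k _)]
    rw [lintegral_add_left hka, ← lintegral_mul_condLExp hle ham hk,
      ← lintegral_mul_condLExp hle hcm hk, ← lintegral_add_left hkca]
    refine lintegral_mono_ae ?_
    filter_upwards [condLExp_add_le_errorScale_sq H.summable_a H.summable_c n] with ω hω
    rw [← mul_add]
    refine (mul_le_mul_right hω _).trans_eq ?_
    rw [← hξ, hkdef, ← ENNReal.coe_mul]
    congr 1
    have : ξ ω ≠ 0 := errorScale_ne_zero P (history x) a c n ω
    field_simp
    ring
  have hpoint : ∀ ω, (h ω : ℝ≥0∞) * (weightedNormSq w (x (n + 1) ω - z) + (g ω : ℝ≥0)) ≤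
      ((h ω * (1 + ξ ω) : ℝ≥0) : ℝ≥0∞) * (Y ω + g ω) +
        K * (((h ω * (1 + (ξ ω)⁻¹) : ℝ≥0) : ℝ≥0∞) * (‖a n ω‖ₑ ^ 2 + ‖c n ω‖ₑ ^ 2)) := by
    intro ω
    simp only [enorm_eq_nnnorm]
    norm_cast
    have h1 := H.weightedNormSq_step_le z w n ω (errorScale_ne_zero P (history x) a c n ω)
    have h2 : g ω ≤ (1 + ξ ω) * g ω := le_mul_of_one_le_left zero_le le_self_add
    calc h ω * (weightedNormSq w (x (n + 1) ω - z) + g ω)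
        ≤ h ω * (((1 + ξ ω) * Y ω + K * ((1 + (ξ ω)⁻¹) * (‖a n ω‖₊ ^ 2 + ‖c n ω‖₊ ^ 2))) +
            (1 + ξ ω) * g ω) := mul_le_mul_right (add_le_add h1 h2) _
      _ = _ := by ring
  have hm2 : Measurable fun ω =>
      ((h ω * (1 + (ξ ω)⁻¹) : ℝ≥0) : ℝ≥0∞) * (‖a n ω‖ₑ ^ 2 + ‖c n ω‖ₑ ^ 2) :=
    ((hh.mul (measurable_const.add hξm.inv)).mono hle le_rfl).coe_nnreal_ennreal.mul
      ((((H.measurable_a n).enorm).pow_const 2).add (((H.measurable_c n).enorm).pow_const 2))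
  have hm3 : Measurable fun ω => ((h ω * (ξ ω * (1 + ξ ω)) : ℝ≥0) : ℝ≥0∞) :=
    ((hh.mul (hξm.mul (measurable_const.add hξm))).mono hle le_rfl).coe_nnreal_ennreal
  refine (lintegral_mono hpoint).trans ?_
  rw [lintegral_add_right _ (hm2.const_mul _), lintegral_const_mul _ hm2]
  refine (add_le_add hact (mul_le_mul_right hcond _)).trans_eq ?_
  rw [← lintegral_const_mul _ hm3, ← lintegral_add_right _ (hm3.const_mul _)]
  refine lintegral_congr fun ω => ?_
  simp only [weightedNormSq, PiLp.sub_apply]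
  norm_cast
  ring

/-- The residuals are summable and the weighted distances to a solution converge. -/
theorem ae_summable_residual_and_tendsto (H : RandomForwardBackward P A B ϑ δ γ lam x a c ε)
    {z : PiLp 2 E} (hz : z ∈ solutions A B) :
    ∀ᵐ ω ∂P, Summable (fun n => residual A B (γ n) z (x n ω)) ∧
      ∃ l : ℝ≥0, Tendsto (fun n => weightedNormSq (activationWeight P (ε 0)) (x n ω - z)) atTop
        (𝓝 l) := by
  have : BorelSpace (PiLp 2 E) := borelSpace_directSum
  have hsec : ∀ i, SecondCountableTopology (E i) := fun i =>
    UniformSpace.secondCountable_of_separable (E i)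
  have hBc := H.cocoercive.continuous H.ϑ_pos
  have hTc := fun n => continuous_forwardBackward H.maximallyMonotone hBc (H.γ_mem n).1
  have happ : ∀ i, Continuous fun y : PiLp 2 E => y i := fun i => PiLp.continuous_apply 2 E i
  have hξm := measurable_errorScale P (history x) a c
  have hξs := summable_errorScale H.summable_a H.summable_c
  have key := ae_summable_and_tendsto_of_almost_supermartingale (P := P)
    (ℱ := historyFiltration x H.measurable_iterate)
    (V := fun n ω => weightedNormSq (activationWeight P (ε 0)) (x n ω - z))
    (g := fun n ω => δ * residual A B (γ n) z (x n ω))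
    (ξ := errorScale P (history x) a c)
    (β := fun n ω => (∑ i, activationWeight P (ε 0) i) * (2 + 8 * ϑ.toNNReal ^ 2) *
            (errorScale P (history x) a c n ω * (1 + errorScale P (history x) a c n ω)))
    (fun n => by
      have : Continuous fun y : PiLp 2 E => weightedNormSq (activationWeight P (ε 0)) (y - z) := by
        unfold weightedNormSq; simp only [PiLp.sub_apply]; fun_prop
      exact this.measurable.comp (measurable_history x n))
    (fun n => by
      have : Continuous fun y : PiLp 2 E => δ * residual A B (γ n) z y := by
        have := hTc n
        unfold residual; fun_prop
      exact this.measurable.comp (measurable_history x n))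
    hξm (fun n => ((hξm n).mul (measurable_const.add (hξm n))).const_mul _) hξs (by
      filter_upwards [hξs] with ω hω
      refine Summable.mul_left _ (NNReal.summable_of_le (fun n => ?_)
        (hω.mul_right (1 + ∑' n, errorScale P (history x) a c n ω)))
      gcongr
      exact hω.le_tsum n fun _ _ => zero_le)
    (fun n h hh => H.lintegral_quasiFejer hz n hh)
  filter_upwards [key] with ω hω
  refine ⟨?_, hω.2⟩
  simpa [← mul_assoc, inv_mul_cancel₀ H.δ_pos.ne'] using hω.1.mul_left δ⁻¹

end RandomForwardBackward

end Iteration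

end MonOp
namespace MonOp

section Opial

variable {H : Type*} [NormedAddCommGroup H] [InnerProductSpace ℝ H] [CompleteSpace H] {ι : Type*}

theorem TendstoWeakly.map {H' : Type*} [NormedAddCommGroup H'] [InnerProductSpace ℝ H']
    [CompleteSpace H'] {l : Filter ι} {x : ι → H} {w : H} (h : TendstoWeakly l x w)
    (S : H →L[ℝ] H') : TendstoWeakly l (fun n => S (x n)) (S w) := by
  intro v
  simp only [← ContinuousLinearMap.adjoint_inner_right]
  exact h _

/-- Opial's lemma, for distances distorted by an injective operator. -/
theorem exists_tendstoWeakly_of_opial {y : ℕ → H} {R : ℝ} (hR : ∀ n, ‖y n‖ ≤ R) {F : Set H}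
    (S : H →L[ℝ] H) (hS : Function.Injective S)
    (hconv : ∀ z ∈ F, ∃ l : ℝ, Tendsto (fun n => ‖S (y n - z)‖) atTop (𝓝 l))
    (hF : ∀ (𝒰 : Ultrafilter ℕ) (w : H), (𝒰 : Filter ℕ) ≤ atTop → TendstoWeakly 𝒰 y w → w ∈ F) :
    ∃ y' ∈ F, TendstoWeakly atTop y y' := by
  obtain ⟨y', hy'⟩ := exists_tendstoWeakly_of_bounded (Ultrafilter.of atTop) hR
  have hy'F := hF _ y' (Ultrafilter.of_le atTop) hy'
  refine ⟨y', hy'F, fun v => (tendsto_iff_ultrafilter _ _ _).2 fun 𝒰 h𝒰 => ?_⟩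
  obtain ⟨w, hw⟩ := exists_tendstoWeakly_of_bounded 𝒰 hR
  have hwF := hF 𝒰 w h𝒰 hw
  suffices w = y' by rw [← this]; exact hw v
  obtain ⟨l, hl⟩ := hconv w hwF
  obtain ⟨l', hl'⟩ := hconv y' hy'F
  have hinner : Tendsto (fun n => ⟪S (y n), S (w - y')⟫) atTop
      (𝓝 ((‖S w‖ ^ 2 - ‖S y'‖ ^ 2 - (l ^ 2 - l' ^ 2)) / 2)) := by
    refine (((hl.pow 2).sub (hl'.pow 2)).const_sub (‖S w‖ ^ 2 - ‖S y'‖ ^ 2) |>.div_const 2).congr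
      fun n => ?_
    rw [map_sub, map_sub, map_sub, norm_sub_sq_real, norm_sub_sq_real, inner_sub_right]
    ring
  have h1 := tendsto_nhds_unique (hinner.mono_left h𝒰) (hw.map S (S (w - y')))
  have h2 := tendsto_nhds_unique (hinner.mono_left (Ultrafilter.of_le atTop))
    (hy'.map S (S (w - y')))
  have h3 : ⟪S (w - y'), S (w - y')⟫ = 0 := by
    conv_lhs => rw [map_sub, inner_sub_left, ← map_sub]
    rw [← h1, ← h2, sub_self]
  have h4 : S w = S y' := by
    rw [inner_self_eq_zero, map_sub, sub_eq_zero] at h3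
    exact h3
  exact hS h4

omit [CompleteSpace H] in
/-- A sequence whose distorted distances to the points of `D` converge has convergent distorted
distances to the points of the closure of `D`. -/
theorem exists_tendsto_norm_of_mem_closure (S : H →L[ℝ] H) {y : ℕ → H} {D : Set H}
    (hD : ∀ z ∈ D, ∃ l : ℝ, Tendsto (fun n => ‖S (y n - z)‖) atTop (𝓝 l)) {z : H}
    (hz : z ∈ closure D) : ∃ l : ℝ, Tendsto (fun n => ‖S (y n - z)‖) atTop (𝓝 l) := by
  refine cauchySeq_tendsto_of_complete (Metric.cauchySeq_iff.2 fun e he => ?_)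
  have hcl : S z ∈ closure (S '' D) := mem_closure_image S.continuous.continuousAt hz
  obtain ⟨_, ⟨z', hz', rfl⟩, hd⟩ := Metric.mem_closure_iff.1 hcl (e / 3) (by positivity)
  obtain ⟨l, hl⟩ := hD z' hz'
  obtain ⟨N, hN⟩ := Metric.cauchySeq_iff.1 hl.cauchySeq (e / 3) (by positivity)
  have hclose : ∀ n, |‖S (y n - z)‖ - ‖S (y n - z')‖| < e / 3 := by
    intro n
    refine (abs_norm_sub_norm_le _ _).trans_lt ?_
    rw [← map_sub, sub_sub_sub_cancel_left, map_sub, ← dist_eq_norm, dist_comm]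
    exact hd
  refine ⟨N, fun k hk n hn => ?_⟩
  have h0 := hN k hk n hn
  have h1 := hclose k
  have h2 := hclose n
  rw [Real.dist_eq, abs_lt] at h0 ⊢
  rw [abs_lt] at h1 h2
  constructor <;> linarith

end Opial

section WeakMeasurability

variable {H : Type*} [NormedAddCommGroup H] [InnerProductSpace ℝ H] [SecondCountableTopology H]
  [MeasurableSpace H] [BorelSpace H] {Ω : Type*} [MeasurableSpace Ω]

omit [MeasurableSpace H] [BorelSpace H] in
theorem measurable_norm_of_measurable_inner {f : Ω → H}
    (hf : ∀ v : H, Measurable fun ω => ⟪f ω, v⟫) : Measurable fun ω => ‖f ω‖ := by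
  refine measurable_of_Iic fun r => ?_
  rcases lt_or_ge r 0 with hr | hr
  · have : (fun ω => ‖f ω‖) ⁻¹' Iic r = ∅ :=
      eq_empty_of_forall_notMem fun ω hω => (hr.trans_le (norm_nonneg (f ω))).not_ge hω
    rw [this]
    exact MeasurableSet.empty
  · have : (fun ω => ‖f ω‖) ⁻¹' Iic r =
        ⋂ k, {ω | ⟪f ω, TopologicalSpace.denseSeq H k⟫ ≤ r * ‖TopologicalSpace.denseSeq H k‖} := by
      ext ω
      simp only [mem_preimage, mem_Iic, mem_iInter, mem_ofPred_eq]
      constructor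
      · exact fun h k => (real_inner_le_norm _ _).trans
          (mul_le_mul_of_nonneg_right h (norm_nonneg _))
      · intro h
        have hall : ∀ v : H, ⟪f ω, v⟫ ≤ r * ‖v‖ := fun v =>
          (TopologicalSpace.denseRange_denseSeq H).induction_on
            (p := fun v => ⟪f ω, v⟫ ≤ r * ‖v‖) v
            (isClosed_le (by fun_prop) (by fun_prop)) h
        have h1 := hall (f ω)
        rw [real_inner_self_eq_norm_sq, sq] at h1
        rcases (norm_nonneg (f ω)).eq_or_lt with h0 | h0
        · rw [← h0]; exact hr
        · exact le_of_mul_le_mul_right h1 h0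
    rw [this]
    exact MeasurableSet.iInter fun k => measurableSet_le (hf _) measurable_const

/-- Weakly measurable functions into a separable Hilbert space are measurable. -/
theorem measurable_of_measurable_inner {f : Ω → H}
    (hf : ∀ v : H, Measurable fun ω => ⟪f ω, v⟫) : Measurable f := by
  refine measurable_of_isClosed fun s hs => ?_
  obtain ⟨D, hDs, hDc, hsD⟩ :=
    (TopologicalSpace.IsSeparable.of_separableSpace s).exists_countable_dense_subset
  have : f ⁻¹' s = ⋂ k : ℕ, ⋃ d ∈ D, {ω | ‖f ω - d‖ < 1 / ((k : ℝ) + 1)} := by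
    ext ω
    simp only [mem_preimage, mem_iInter, mem_iUnion, mem_ofPred_eq, exists_prop]
    constructor
    · intro h k
      obtain ⟨d, hd, hdist⟩ := Metric.mem_closure_iff.1 (hsD h) _ (Nat.one_div_pos_of_nat (n := k))
      exact ⟨d, hd, by rwa [← dist_eq_norm]⟩
    · intro h
      refine hs.closure_subset_iff.2 hDs (Metric.mem_closure_iff.2 fun e he => ?_)
      obtain ⟨k, hk⟩ := exists_nat_one_div_lt he
      obtain ⟨d, hd, hdist⟩ := h k
      exact ⟨d, hd, by rw [dist_eq_norm]; exact hdist.trans hk⟩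
  rw [this]
  refine MeasurableSet.iInter fun k => MeasurableSet.biUnion hDc fun d _ =>
    measurableSet_lt (measurable_norm_of_measurable_inner fun v => ?_) measurable_const
  simp only [inner_sub_left]
  exact (hf v).sub_const _

end WeakMeasurability

section Blocks

open scoped NNReal

variable {m : ℕ} {E : Fin m → Type*} [∀ i, NormedAddCommGroup (E i)]
  [∀ i, InnerProductSpace ℝ (E i)]

/-- The operator that multiplies the blocks by scalars. -/
noncomputable def blockScale (E : Fin m → Type*) [∀ i, NormedAddCommGroup (E i)]
    [∀ i, InnerProductSpace ℝ (E i)] (s : Fin m → ℝ) : PiLp 2 E →L[ℝ] PiLp 2 E :=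
  (PiLp.continuousLinearEquiv 2 ℝ E).symm.toContinuousLinearMap ∘L
    ContinuousLinearMap.pi fun i => s i • PiLp.proj 2 E i

@[simp]
theorem blockScale_apply (s : Fin m → ℝ) (x : PiLp 2 E) (i : Fin m) :
    blockScale E s x i = s i • x i := rfl

theorem blockScale_inv {s : Fin m → ℝ} (hs : ∀ i, s i ≠ 0) (x : PiLp 2 E) :
    blockScale E (fun i => (s i)⁻¹) (blockScale E s x) = x := by
  ext i
  simp [inv_smul_smul₀ (hs i)]

theorem norm_blockScale_sqrt (w : Fin m → ℝ≥0) (x : PiLp 2 E) :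
    ‖blockScale E (fun i => √(w i)) x‖ = √(weightedNormSq w x) := by
  rw [← Real.sqrt_sq (norm_nonneg (blockScale E _ x)), PiLp.norm_sq_eq_of_L2]
  simp [weightedNormSq, norm_smul, mul_pow]

end Blocks

section Trajectories

open scoped NNReal

variable {m : ℕ} {E : Fin m → Type*} [∀ i, NormedAddCommGroup (E i)]
  [∀ i, InnerProductSpace ℝ (E i)] [∀ i, CompleteSpace (E i)]
  {A : ∀ i, E i → Set (E i)} {B : ∀ i, PiLp 2 E → E i}

/-- A trajectory with vanishing forward-backward residuals. -/
structure VanishingResidual (A : ∀ i, E i → Set (E i)) (B : ∀ i, PiLp 2 E → E i) (γ : ℕ → ℝ)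
    (z : PiLp 2 E) (y : ℕ → PiLp 2 E) : Prop where
  tendsto_B : Tendsto (fun n => blockMap B (y n)) atTop (𝓝 (blockMap B z))
  tendsto_sub : Tendsto (fun n => forwardBackward A B (γ n) (y n) - y n) atTop (𝓝 0)
  tendsto_dual : ∀ i, Tendsto (fun n => (γ n)⁻¹ •
    (y n i - γ n • B i (y n) - forwardBackward A B (γ n) (y n) i)) atTop (𝓝 (-B i z))

omit [∀ i, CompleteSpace (E i)] in
theorem vanishingResidual_of_tendsto {γ : ℕ → ℝ} {γ₀ γ₁ : ℝ} (hγ₀ : 0 < γ₀)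
    (hγ : ∀ n, γ n ∈ Icc γ₀ γ₁) {z : PiLp 2 E} {y : ℕ → PiLp 2 E}
    (h : Tendsto (fun n => residual A B (γ n) z (y n)) atTop (𝓝 0)) :
    VanishingResidual A B γ z y := by
  have hsq : ∀ {f : ℕ → PiLp 2 E}, (∀ n, ‖f n‖₊ ^ 2 ≤ residual A B (γ n) z (y n)) →
      Tendsto f atTop (𝓝 0) := by
    intro f hf
    have h1 : Tendsto (fun n => ‖f n‖₊ ^ 2) atTop (𝓝 0) :=
      tendsto_of_tendsto_of_tendsto_of_le_of_le tendsto_const_nhds h (fun _ => zero_le) hf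
    have h2 := (NNReal.continuous_sqrt.tendsto 0).comp h1
    rw [NNReal.sqrt_zero] at h2
    rw [tendsto_zero_iff_norm_tendsto_zero, ← NNReal.coe_zero]
    refine (NNReal.tendsto_coe.2 h2).congr fun n => ?_
    simp
  have hB : Tendsto (fun n => blockMap B (y n) - blockMap B z) atTop (𝓝 0) :=
    hsq fun n => le_self_add
  have hr : Tendsto (fun n => y n - forwardBackward A B (γ n) (y n) -
      γ n • (blockMap B (y n) - blockMap B z)) atTop (𝓝 0) := hsq fun n => le_add_self
  have hbd : ∀ {f : ℕ → PiLp 2 E} {t : ℕ → ℝ} {K : ℝ}, (∀ n, |t n| ≤ K) →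
      Tendsto f atTop (𝓝 0) → Tendsto (fun n => t n • f n) atTop (𝓝 0) := by
    intro f t K ht hf
    have h0 : Tendsto (fun n => K * ‖f n‖) atTop (𝓝 0) := by
      simpa using (tendsto_zero_iff_norm_tendsto_zero.1 hf).const_mul K
    refine squeeze_zero_norm (fun n => ?_) h0
    rw [norm_smul, Real.norm_eq_abs]
    exact mul_le_mul_of_nonneg_right (ht n) (norm_nonneg _)
  have hγpos : ∀ n, 0 < γ n := fun n => hγ₀.trans_le (hγ n).1
  have hγB := hbd (K := γ₁) (t := γ) (fun n => by
    rw [abs_of_pos (hγpos n)]; exact (hγ n).2) hB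
  have hγr := hbd (K := γ₀⁻¹) (t := fun n => (γ n)⁻¹) (fun n => by
    rw [abs_of_pos (inv_pos.2 (hγpos n))]
    exact inv_anti₀ hγ₀ (hγ n).1) hr
  have hBz : Tendsto (fun n => blockMap B (y n)) atTop (𝓝 (blockMap B z)) :=
    tendsto_sub_nhds_zero_iff.1 hB
  refine ⟨hBz, ?_, fun i => ?_⟩
  · have := (hr.add hγB).neg
    simpa using this
  · have h1 := (hγr.sub (tendsto_const_nhds (x := blockMap B z)))
    have h2 := ((PiLp.continuous_apply 2 E i).tendsto _).comp h1
    refine (h2.congr fun n => ?_).trans_eq ?_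
    · simp only [Function.comp_apply, PiLp.sub_apply, PiLp.smul_apply, blockMap]
      rw [smul_sub, smul_sub, inv_smul_smul₀ (hγpos n).ne', smul_sub, smul_sub,
        inv_smul_smul₀ (hγpos n).ne']
      abel
    · simp [blockMap]

theorem VanishingResidual.tendstoWeakly_forwardBackward {γ : ℕ → ℝ} {z : PiLp 2 E}
    {y : ℕ → PiLp 2 E} (h : VanishingResidual A B γ z y) {l : Filter ℕ} (hl : l ≤ atTop)
    {y' : PiLp 2 E} (hy : TendstoWeakly l y y') (i : Fin m) :
    TendstoWeakly l (fun n => forwardBackward A B (γ n) (y n) i) (y' i) :=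
  (hy.add_tendsto_zero (h.tendsto_sub.mono_left hl)).map (PiLp.proj 2 E i : PiLp 2 E →L[ℝ] E i)

omit [∀ i, CompleteSpace (E i)] in
/-- Cocoercive operators are weak-strong closed along convergent values. -/
theorem VanishingResidual.blockMap_eq {ϑ : ℝ} (hϑ : 0 < ϑ) (hB : Cocoercive ϑ (blockMap B))
    {γ : ℕ → ℝ} {z : PiLp 2 E} {y : ℕ → PiLp 2 E} (h : VanishingResidual A B γ z y) {R : ℝ}
    (hR : ∀ n, ‖y n‖ ≤ R) {l : Filter ℕ} [l.NeBot] (hl : l ≤ atTop) {y' : PiLp 2 E}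
    (hy : TendstoWeakly l y y') : blockMap B y' = blockMap B z := by
  have hBl := h.tendsto_B.mono_left hl
  have hy' : TendstoWeakly l (fun n => y n - y') 0 := fun p => by
    simpa [inner_sub_left] using (hy p).sub_const ⟪y', p⟫
  have h1 := hy'.inner (R := R + ‖y'‖) (fun n => (norm_sub_le _ _).trans (by gcongr; exact hR n))
    (hBl.sub_const (blockMap B y'))
  have h2 := ((hBl.sub_const (blockMap B y')).norm.pow 2).const_mul ϑ
  have h3 := le_of_tendsto_of_tendsto' h2 h1 fun n => hB (y n) y'
  rw [inner_zero_left] at h3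
  have h4 : ‖blockMap B z - blockMap B y'‖ ^ 2 = 0 :=
    le_antisymm (nonpos_of_mul_nonpos_right h3 hϑ) (sq_nonneg _)
  exact (sub_eq_zero.1 (norm_eq_zero.1 ((pow_eq_zero_iff two_ne_zero).1 h4))).symm

theorem VanishingResidual.mem_solutions (hA : ∀ i, IsMaximallyMonotone (A i)) {ϑ : ℝ} (hϑ : 0 < ϑ)
    (hB : Cocoercive ϑ (blockMap B)) {γ : ℕ → ℝ} (hγ : ∀ n, 0 < γ n) {z : PiLp 2 E}
    {y : ℕ → PiLp 2 E} (h : VanishingResidual A B γ z y) {R : ℝ} (hR : ∀ n, ‖y n‖ ≤ R)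
    {l : Filter ℕ} [l.NeBot] (hl : l ≤ atTop) {y' : PiLp 2 E} (hy : TendstoWeakly l y y') :
    y' ∈ solutions A B := by
  refine mem_solutions_iff.2 fun i => ?_
  have hBi : B i y' = B i z := congrArg (fun u : PiLp 2 E => u i) (h.blockMap_eq hϑ hB hR hl hy)
  rw [hBi]
  obtain ⟨K, hK⟩ := (Metric.isBounded_range_of_tendsto _ h.tendsto_sub).exists_norm_le
  refine (hA i).mem_of_tendsto (R := K + R) (fun n => ?_)
    (h.tendstoWeakly_forwardBackward hl hy i) ((h.tendsto_dual i).mono_left hl)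
    (fun n => smul_sub_forwardBackward_mem hA (hγ n) (y n) i)
  refine (PiLp.norm_apply_le _ i).trans ?_
  have h1 := norm_add_le (forwardBackward A B (γ n) (y n) - y n) (y n)
  rw [sub_add_cancel] at h1
  exact h1.trans (add_le_add (hK _ (mem_range_self n)) (hR n))

/-- Demiregularity of either operator upgrades weak convergence to strong convergence. -/
theorem VanishingResidual.tendsto_of_demiregular (hA : ∀ i, IsMaximallyMonotone (A i)) {ϑ : ℝ}
    (hϑ : 0 < ϑ) (hB : Cocoercive ϑ (blockMap B)) {γ : ℕ → ℝ} (hγ : ∀ n, 0 < γ n) {z : PiLp 2 E}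
    {y : ℕ → PiLp 2 E} (h : VanishingResidual A B γ z y) {R : ℝ} (hR : ∀ n, ‖y n‖ ≤ R)
    {y' : PiLp 2 E} (hy : TendstoWeakly atTop y y')
    (hdemi : (∀ i, DemiregularAt (A i) (y' i)) ∨ DemiregularAt (fun u => {blockMap B u}) y') :
    Tendsto y atTop (𝓝 y') := by
  have hBeq := h.blockMap_eq hϑ hB hR le_rfl hy
  rcases hdemi with hd | hd
  · have hsol := h.mem_solutions hA hϑ hB hγ hR le_rfl hy
    have hT : Tendsto (fun n => forwardBackward A B (γ n) (y n)) atTop (𝓝 y') := by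
      have h1 : ∀ i, Tendsto (fun n => forwardBackward A B (γ n) (y n) i) atTop (𝓝 (y' i)) := by
        intro i
        refine (hd i).2 _ _ (fun n => smul_sub_forwardBackward_mem hA (hγ n) (y n) i) (-B i y')
          (mem_solutions_iff.1 hsol i)
          ((weaklyTendsTo_iff _ _).2 (h.tendstoWeakly_forwardBackward le_rfl hy i)) ?_
        have hBi : B i y' = B i z := congrArg (fun u : PiLp 2 E => u i) hBeq
        rw [hBi]
        exact h.tendsto_dual i
      exact ((PiLp.continuous_toLp 2 E).tendsto _).comp (tendsto_pi_nhds.2 h1)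
    have := hT.sub h.tendsto_sub
    simpa using this
  · refine hd.2 y (fun n => blockMap B (y n)) (fun n => rfl) (blockMap B y') rfl
      ((weaklyTendsTo_iff _ _).2 hy) ?_
    rw [hBeq]
    exact h.tendsto_B

/-- Weak convergence of a quasi-Fejér trajectory with vanishing residuals. -/
theorem VanishingResidual.exists_tendstoWeakly (hA : ∀ i, IsMaximallyMonotone (A i)) {ϑ : ℝ}
    (hϑ : 0 < ϑ) (hB : Cocoercive ϑ (blockMap B)) {γ : ℕ → ℝ} (hγ : ∀ n, 0 < γ n) {z : PiLp 2 E}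
    {y : ℕ → PiLp 2 E} (h : VanishingResidual A B γ z y) {w : Fin m → ℝ≥0} (hw : ∀ i, 0 < w i)
    {D : Set (PiLp 2 E)} (hD : solutions A B ⊆ closure D) (hzD : z ∈ D)
    (hconv : ∀ z ∈ D, ∃ l : ℝ≥0, Tendsto (fun n => weightedNormSq w (y n - z)) atTop (𝓝 l)) :
    ∃ R, (∀ n, ‖y n‖ ≤ R) ∧ ∃ y' ∈ solutions A B, TendstoWeakly atTop y y' := by
  have hs : ∀ i, √(w i : ℝ) ≠ 0 := fun i => (Real.sqrt_pos.2 (NNReal.coe_pos.2 (hw i))).ne'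
  set S := blockScale E fun i => √(w i : ℝ) with hS
  set S' := blockScale E fun i => (√(w i : ℝ))⁻¹ with hS'
  have hinv : ∀ u, S' (S u) = u := blockScale_inv hs
  have hconvS : ∀ z ∈ D, ∃ l : ℝ, Tendsto (fun n => ‖S (y n - z)‖) atTop (𝓝 l) := by
    intro z hz
    obtain ⟨l, hl⟩ := hconv z hz
    refine ⟨√l, ?_⟩
    simp only [hS, norm_blockScale_sqrt]
    exact (NNReal.tendsto_coe.2 hl).sqrt
  obtain ⟨l, hl⟩ := hconvS z hzD
  obtain ⟨K, hK⟩ := hl.bddAbove_range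
  have hR : ∀ n, ‖y n‖ ≤ ‖S'‖ * K + ‖z‖ := by
    intro n
    calc ‖y n‖ = ‖S' (S (y n - z)) + z‖ := by rw [hinv, sub_add_cancel]
      _ ≤ ‖S'‖ * ‖S (y n - z)‖ + ‖z‖ := (norm_add_le _ _).trans
        (add_le_add (S'.le_opNorm _) le_rfl)
      _ ≤ _ := by
        gcongr
        exact hK (mem_range_self n)
  exact ⟨_, hR, exists_tendstoWeakly_of_opial hR S (Function.LeftInverse.injective hinv)
    (fun z hz => exists_tendsto_norm_of_mem_closure S hconvS (hD hz))
    fun 𝒰 w' h𝒰 hw' => h.mem_solutions hA hϑ hB hγ hR h𝒰 hw'⟩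

end Trajectories

end MonOp
namespace MonOp

section Convergence

open scoped NNReal

variable {Ω : Type*} [mΩ : MeasurableSpace Ω] {m : ℕ} {E : Fin m → Type*}
  [∀ i, NormedAddCommGroup (E i)] [∀ i, InnerProductSpace ℝ (E i)] [∀ i, CompleteSpace (E i)]
  [∀ i, TopologicalSpace.SeparableSpace (E i)] [∀ i, MeasurableSpace (E i)]
  [∀ i, BorelSpace (E i)]

/-- The iterates of the perturbed random iteration are measurable. -/
theorem measurable_iterates {A : ∀ i, E i → Set (E i)} {B : ∀ i, PiLp 2 E → E i}
    (hA : ∀ i, IsMaximallyMonotone (A i)) (hB : Continuous (blockMap B)) {γ lam : ℕ → ℝ}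
    (hγ : ∀ n, 0 < γ n) {x a c : ℕ → Ω → PiLp 2 E} {ε : ℕ → Ω → Fin m → ℝ}
    (hx₀ : Measurable (x 0)) (ha : ∀ n, Measurable (a n)) (hc : ∀ n, Measurable (c n))
    (hε : ∀ n, Measurable (ε n))
    (hx : ∀ n ω i, x (n + 1) ω i = x n ω i + (ε n ω i * lam n) •
      (J (γ n • A i) (x n ω i - γ n • (B i (x n ω) + c n ω i)) + a n ω i - x n ω i)) (n : ℕ) :
    Measurable (x n) := by
  have hbor : BorelSpace (PiLp 2 E) := borelSpace_directSum
  have hsec : ∀ i, SecondCountableTopology (E i) := fun i =>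
    UniformSpace.secondCountable_of_separable (E i)
  have happ : ∀ i, Measurable fun y : PiLp 2 E => y i := fun i =>
    (PiLp.continuous_apply 2 E i).measurable
  induction n with
  | zero => exact hx₀
  | succ n ih =>
    have hcoord : ∀ i, Measurable fun ω => x (n + 1) ω i := by
      intro i
      simp only [hx n]
      have hBi : Measurable (B i) := (continuous_of_continuous_blockMap hB i).measurable
      have hJ : Measurable (J (γ n • A i)) := ((hA i).continuous_J (hγ n)).measurable
      have hxi : Measurable fun ω => x n ω i := (happ i).comp ih
      have hci : Measurable fun ω => c n ω i := (happ i).comp (hc n)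
      have hai : Measurable fun ω => a n ω i := (happ i).comp (ha n)
      have hεi : Measurable fun ω => ε n ω i := (measurable_pi_apply i).comp (hε n)
      exact hxi.add ((hεi.mul_const _).smul (((hJ.comp
        (hxi.sub (((hBi.comp ih).add hci).const_smul _))).add hai).sub hxi))
    have : x (n + 1) = fun ω => WithLp.toLp 2 fun i => x (n + 1) ω i := rfl
    rw [this]
    exact (WithLp.measurable_toLp 2 _).comp (measurable_pi_lambda _ hcoord)

namespace RandomForwardBackward

variable {P : Measure Ω} [IsProbabilityMeasure P] {A : ∀ i, E i → Set (E i)}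
    {B : ∀ i, PiLp 2 E → E i} {ϑ : ℝ} {δ : ℝ≥0} {γ lam : ℕ → ℝ} {x a c : ℕ → Ω → PiLp 2 E}
    {ε : ℕ → Ω → Fin m → ℝ}

/-- Almost every trajectory is bounded, has vanishing residuals, and converges weakly to a
solution. -/
theorem ae_exists_tendstoWeakly (H : RandomForwardBackward P A B ϑ δ γ lam x a c ε)
    {z : PiLp 2 E} (hz : z ∈ solutions A B) :
    ∀ᵐ ω ∂P, VanishingResidual A B γ z (fun n => x n ω) ∧ ∃ R, (∀ n, ‖x n ω‖ ≤ R) ∧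
      ∃ y' ∈ solutions A B, TendstoWeakly atTop (fun n => x n ω) y' := by
  have hsec : ∀ i, SecondCountableTopology (E i) := fun i =>
    UniformSpace.secondCountable_of_separable (E i)
  obtain ⟨D, hDF, hDc, hD⟩ := (TopologicalSpace.IsSeparable.of_separableSpace
    (solutions A B)).exists_countable_dense_subset
  have hall := (ae_ball_iff hDc).2 fun z' hz' => H.ae_summable_residual_and_tendsto (hDF hz')
  filter_upwards [hall, H.ae_summable_residual_and_tendsto hz] with ω hω hzω
  have hvan : VanishingResidual A B γ z fun n => x n ω :=
    vanishingResidual_of_tendsto (div_pos (NNReal.coe_pos.2 H.δ_pos) (by linarith [H.ϑ_pos]))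
      H.γ_bounds (NNReal.tendsto_atTop_zero_of_summable hzω.1)
  refine ⟨hvan, hvan.exists_tendstoWeakly H.maximallyMonotone H.ϑ_pos H.cocoercive
    (fun n => (H.γ_mem n).1) H.activationWeight_pos (D := insert z D)
    (hD.trans (closure_mono (subset_insert _ _))) (mem_insert _ _) fun z' hz' => ?_⟩
  rcases hz' with rfl | hz'
  · exact hzω.2
  · exact (hω z' hz').2

end RandomForwardBackward

/-- An almost sure weak limit has a measurable version. -/
theorem exists_measurable_weakLimit {H : Type*} [NormedAddCommGroup H] [InnerProductSpace ℝ H]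
    [SecondCountableTopology H] [MeasurableSpace H] [BorelSpace H] {P : Measure Ω}
    {x : ℕ → Ω → H} (hx : ∀ n, Measurable (x n)) {F : Set H} {z : H} (hz : z ∈ F)
    (h : ∀ᵐ ω ∂P, ∃ y' ∈ F, TendstoWeakly atTop (fun n => x n ω) y') :
    ∃ x' : Ω → H, Measurable x' ∧ (∀ ω, x' ω ∈ F) ∧
      ∀ᵐ ω ∂P, TendstoWeakly atTop (fun n => x n ω) (x' ω) := by
  classical
  let N := toMeasurable P {ω | ∃ y' ∈ F, TendstoWeakly atTop (fun n => x n ω) y'}ᶜ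
  have hN : MeasurableSet N := measurableSet_toMeasurable _ _
  have hN0 : P N = 0 := (measure_toMeasurable _).trans h
  have hex : ∀ ω, ∃ y' ∈ F, TendstoWeakly atTop (fun n => N.piecewise (fun _ => z) (x n) ω) y' := by
    intro ω
    by_cases hω : ω ∈ N
    · exact ⟨z, hz, fun v => by simp [hω]⟩
    · have : ω ∈ {ω | ∃ y' ∈ F, TendstoWeakly atTop (fun n => x n ω) y'} := by
        by_contra hc
        exact hω (subset_toMeasurable P _ hc)
      simpa [hω] using this
  choose x' hx'F hx' using hex
  refine ⟨x', measurable_of_measurable_inner fun v => ?_, hx'F, ?_⟩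
  · refine measurable_of_tendsto_metrizable (fun n => ?_) (tendsto_pi_nhds.2 fun ω => hx' ω v)
    exact (Measurable.piecewise hN measurable_const (hx n)).inner_const
  · filter_upwards [compl_mem_ae_iff.2 hN0] with ω hω
    have := hx' ω
    simpa [show ω ∉ N from hω] using this

end Convergence

end MonOp

theorem proposition5p9
    {Ω : Type*} [MeasurableSpace Ω] (P : Measure Ω) [IsProbabilityMeasure P]
    {m : ℕ} {E : Fin m → Type*} [∀ i, NormedAddCommGroup (E i)]
    [∀ i, InnerProductSpace ℝ (E i)] [∀ i, CompleteSpace (E i)]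
    [∀ i, TopologicalSpace.SeparableSpace (E i)]
    [∀ i, MeasurableSpace (E i)] [∀ i, BorelSpace (E i)]
    (A : ∀ i, E i → Set (E i)) (hA : ∀ i, MonOp.IsMaximallyMonotone (A i))
    (B : ∀ i, PiLp 2 E → E i) (ϑ : ℝ) (hϑ : 0 < ϑ)
    (hB : ∀ x y : PiLp 2 E,
      ∑ i, ⟪x i - y i, B i x - B i y⟫ ≥ ϑ * ∑ i, ‖B i x - B i y‖ ^ 2)
    (hF : (MonOp.solutions A B).Nonempty)
    (γ : ℕ → ℝ) (hγ : ∀ n, γ n ∈ Ioo 0 (2 * ϑ))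
    (hγ_inf : 0 < ⨅ n, γ n) (hγ_sup : ⨆ n, γ n < 2 * ϑ)
    (lam : ℕ → ℝ) (hlam : ∀ n, lam n ∈ Ioc (0 : ℝ) 1) (hlam_inf : 0 < ⨅ n, lam n)
    (x a c : ℕ → Ω → PiLp 2 E)
    (hx₀ : Measurable (x 0)) (ha : ∀ n, Measurable (a n)) (hc : ∀ n, Measurable (c n))
    (ε : ℕ → Ω → Fin m → ℝ) (hε : ∀ n, Measurable (ε n))
    (hε_mem : ∀ n ω, ε n ω ∈ MonOp.activations m)
    (hε_ident : ∀ n, IdentDistrib (ε n) (ε 0) P P)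
    (hx : ∀ n ω i, x (n + 1) ω i = x n ω i + (ε n ω i * lam n) •
      (MonOp.J (γ n • A i) (x n ω i - γ n • (B i (x n ω) + c n ω i)) + a n ω i - x n ω i))
    (ha_sum : MonOp.SummableCondErrors P (MonOp.history x) a)
    (hc_sum : MonOp.SummableCondErrors P (MonOp.history x) c)
    (hindep : ∀ n, Indep (MeasurableSpace.comap (ε n) inferInstance) (MonOp.history x n) P)
    (hpos : ∀ i, 0 < P {ω | ε 0 ω i = 1}) :
    ∃ x' : Ω → PiLp 2 E, Measurable x' ∧ (∀ ω, x' ω ∈ MonOp.solutions A B) ∧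
      (∀ᵐ ω ∂P, MonOp.WeaklyTendsTo (fun n => x n ω) (x' ω)) ∧
      (((∀ z ∈ MonOp.solutions A B, ∀ i, MonOp.DemiregularAt (A i) (z i)) ∨
          (∀ z ∈ MonOp.solutions A B,
            MonOp.DemiregularAt (fun y => {MonOp.blockMap B y}) z)) →
        ∀ᵐ ω ∂P, Tendsto (fun n => x n ω) atTop (𝓝 (x' ω))) := by
  have hcoco := MonOp.cocoercive_blockMap hB
  have hmeas := MonOp.measurable_iterates hA (hcoco.continuous hϑ) (fun n => (hγ n).1) hx₀ ha hc hε hx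
  have hlam_le : ∀ n, ⨅ k, lam k ≤ lam n := fun n =>
    ciInf_le ⟨0, forall_mem_range.2 fun k => (hlam k).1.le⟩ n
  have hγ_ge : ∀ n, ⨅ k, γ k ≤ γ n := fun n =>
    ciInf_le ⟨0, forall_mem_range.2 fun k => (hγ k).1.le⟩ n
  have hγ_le : ∀ n, γ n ≤ ⨆ k, γ k := fun n =>
    le_ciSup (f := γ) ⟨2 * ϑ, forall_mem_range.2 fun k => (hγ k).2.le⟩ n
  have hgap : 0 < 2 * ϑ - ⨆ n, γ n := sub_pos.2 hγ_sup
  set d := min (⨅ n, lam n) ((⨅ n, lam n) * ((⨅ n, γ n) * (2 * ϑ - ⨆ n, γ n))) with hd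
  have hd_pos : 0 < d := lt_min hlam_inf (mul_pos hlam_inf (mul_pos hγ_inf hgap))
  have hset : ∀ i, MeasurableSet {d : Fin m → ℝ | d i = 1} := fun i =>
    measurable_pi_apply i (measurableSet_singleton 1)
  have H : MonOp.RandomForwardBackward P A B ϑ d.toNNReal γ lam x a c ε :=
    { maximallyMonotone := hA
      ϑ_pos := hϑ
      cocoercive := hcoco
      δ_pos := Real.toNNReal_pos.2 hd_pos
      γ_mem := hγ
      lam_mem := hlam
      δ_le_lam := fun n => by
        rw [Real.coe_toNNReal _ hd_pos.le]
        exact (min_le_left _ _).trans (hlam_le n)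
      δ_le_gain := fun n => by
        rw [Real.coe_toNNReal _ hd_pos.le]
        refine (min_le_right _ _).trans ?_
        exact mul_le_mul (hlam_le n) (mul_le_mul (hγ_ge n) (by linarith [hγ_le n]) hgap.le
          (hγ n).1.le) (mul_nonneg hγ_inf.le hgap.le) (hlam n).1.le
      measurable_iterate := hmeas
      measurable_a := ha
      measurable_c := hc
      measurable_ε := hε
      ε_eq := fun n ω i => (hε_mem n ω).1 i
      step := hx
      summable_a := ha_sum
      summable_c := hc_sum
      indep := hindep
      prob_eq := fun n i => (hε_ident n).measure_mem_eq (hset i)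
      prob_pos := hpos }
  obtain ⟨z, hz⟩ := hF
  have hbor : BorelSpace (PiLp 2 E) := MonOp.borelSpace_directSum
  have hsec : ∀ i, SecondCountableTopology (E i) := fun i =>
    UniformSpace.secondCountable_of_separable (E i)
  have hae := H.ae_exists_tendstoWeakly hz
  obtain ⟨x', hx'm, hx'F, hx'⟩ := MonOp.exists_measurable_weakLimit hmeas hz
    (hae.mono fun ω h => h.2.choose_spec.2)
  refine ⟨x', hx'm, hx'F, hx'.mono fun ω h => (MonOp.weaklyTendsTo_iff _ _).2 h, fun hdemi => ?_⟩
  filter_upwards [hae, hx'] with ω hω hxω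
  obtain ⟨hvan, R, hR, -⟩ := hω
  exact hvan.tendsto_of_demiregular hA hϑ hcoco (fun n => (hγ n).1) hR hxω
    (hdemi.imp (fun h => h _ (hx'F ω)) fun h => h _ (hx'F ω))
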